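/- **Setting.** Let $(\Omega,\mathcal F,\mathbb P)$ be a probability space and $W(k)\in L^2(\Omega;\mathbb R^m)$, $k\in\mathbb N_0$, an i.i.d. sequence with mean $\mu_W$. Let $A\in\mathbb R^{n\times n}$, $B\in\mathbb R^{n\times l}$ with $(A,B)$ stabilizable, $E\in\mathbb R^{n\times m}$, $z\in\mathbb R^n$, and $f(x,u,w)=Ax+Bu+Ew+z$. Let $Q_1,Q_2\in\mathbb R^{n\times n}$ and $R_1,R_2\in\mathbb R^{l\times l}$ be symmetric with $Q_1,Q_2,R_2\ge 0$, $R_1>0$, let $s\in\mathbb R^n$, $v\in\mathbb R^l$, $c\in\mathbb R$, and put $$\ell(X,U)=\mathbb E[X^TQ_1X+U^TR_1U+s^TX+v^TU+c]+\mathrm{Tr}(Q_2\,\mathrm{Cov}(X))+\mathrm{Tr}(R_2\,\mathrm{Cov}(U)).$$ For $X_0\in L^2(\Omega;\mathbb R^n)$ and a control process $U(\cdot)$, let $X_U(\cdot,X_0)$ be the solution of $X(k+1)=f(X(k),U(k),W(k))$, $X(0)=X_0$. The control is *admissible* on the horizon $N$ if for all $k<N$ the random vector $U(k)$ is square integrable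 and (up to null sets) $\sigma(X(0),\dots,X(k))$-measurable, and $W(k)$ is independent of $X(k)$ and of $U(k)$. Put $J_N(X_0,U)=\sum_{k=0}^{N-1}\ell(X_U(k,X_0),U(k))$. Let $\mathcal P_2$ denote the probability measures with finite second moment, $\mathcal K_\infty$ the continuous, strictly increasing, unbounded functions $\alpha:[0,\infty)\to[0,\infty)$ with $\alpha(0)=0$, and $\|x\|_M^2=x^TMx$. **Theorem.** Assume that $(x^s,u^s)$ solves $(I-A)x^s-Bu^s=E\mu_W+z$ and that $(A,Q_1^{1/2})$ is detectable. Then there are a positive semidefinite solution $P$ of the Riccati equation $$P=A^TPA+Q_1+Q_2-A^TPB[R_1+R_2+B^TPB]^{-1}B^TPA,$$ a positive definite $S\in\mathbb R^{n\times n}$, $q\in\mathbb R^n$, a solution $(\tilde x,\tilde u)$ of $(I-A)\tilde x-B\tilde u=0$, a function $\alpha\in\mathcal K_\infty$ and, with $K=-[R_1+R_2+B^TPB]^{-1}B^TPA$ and $\pi(x)=K(x-\tilde x-x^s)+\tilde u+u^s$, a distribution $\varrho\in\mathcal P_2(\mathbb R^n)$ invariant for the closed loop $x\mapsto f(x,\pi(x),w)$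 with noise distributed as $W(0)$, such that the following holds. Let $X^s_{\star}(0)\sim\varrho$ be any initial value for which the process $X^s_\star(k+1)=f(X^s_\star(k),U^s_\star(k),W(k))$, $U^s_\star(k)=\pi(X^s_\star(k))$, has $X^s_\star(k)$ independent of $W(k)$ for all $k$. (Such an initial value exists whenever $\Omega$ carries, for every distribution in $\mathcal P_2(\mathbb R^n)$, a random vector with that distribution independent of the noise sequence $(W(k))_{k\ge0}$.) Then: 1. $(X^s_\star,U^s_\star)$ is a stationary pair: for all $k$, $X^s_\star(k)$ has one and the same distribution in $\mathcal P_2(\mathbb R^n)$, $U^s_\star(k)$ has one and the same distribution in $\mathcal P_2(\mathbb R^l)$, $U^s_\star(k)$ is $\sigma(X^s_\star(0),\dots,X^s_\star(k))$-measurable, and $W(k)$ is independent of $X^s_\star(k)$ and of $U^s_\star(k)$. 2. The problem is strictly dissipative in $L^2$ at this pair with comparison function $\alpha$ and storage function $$\lambda(k,X)=\mathbb E\big[\|X-(X^s_\star(k)-\tilde x)\|_{P+S}^2-\|X-x^s\|_P^2+q^T(X-(X^s_\star(k)-\tilde x))\big],$$ i.e. $\lambda$ is bounded from below on $\mathbb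 N_0\times L^2$ and, for all $k$ and all square integrable $X,U$ each independent of $W(k)$, $$\ell(X,U)-\ell(X^s_\star(k),U^s_\star(k))+\lambda(k,X)-\lambda(k+1,f(X,U,W(k)))\ge\alpha\big(\mathbb E\|X-X^s_\star(k)\|^2\big).$$ 3. (Mean-square turnpike property.) For every $X_0\in L^2(\Omega;\mathbb R^n)$ there is a constant $C\in\mathbb R$ such that for all $N\in\mathbb N_0$, all $\delta>0$, all controls $U(\cdot)$ admissible on the horizon $N$ with $J_N(X_0,U)\le\delta+\sum_{k=0}^{N-1}\ell(X^s_\star(k),U^s_\star(k))$ and all $\varepsilon>0$, $$\#\big\{k\in\{0,\dots,N-1\}:\ \mathbb E\big[\|X_U(k,X_0)-X^s_\star(k)\|^2\big]\le\varepsilon\big\}\ \ge\ N-\frac{\delta+C}{\alpha(\varepsilon)} .$$ -/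

import Mathlib

open MeasureTheory ProbabilityTheory Filter
open scoped Matrix MatrixOrder

noncomputable section

/-- A real square matrix is Schur stable if all its complex eigenvalues have modulus `< 1`. -/
def IsSchur {n : ℕ} (M : Matrix (Fin n) (Fin n) ℝ) : Prop :=
  ∀ μ ∈ spectrum ℂ (M.map (algebraMap ℝ ℂ)), ‖μ‖ < 1

/-- `(A, B)` is stabilizable. -/
def IsStabilizable {n l : ℕ} (A : Matrix (Fin n) (Fin n) ℝ) (B : Matrix (Fin n) (Fin l) ℝ) :
    Prop :=
  ∃ F : Matrix (Fin l) (Fin n) ℝ, IsSchur (A + B * F)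

/-- `(A, C)` is detectable. -/
def IsDetectable {n p : ℕ} (A : Matrix (Fin n) (Fin n) ℝ) (C : Matrix (Fin p) (Fin n) ℝ) :
    Prop :=
  ∃ L : Matrix (Fin n) (Fin p) ℝ, IsSchur (A + L * C)

/-- The class `K∞` of comparison functions on `[0, ∞)`. Values at negative arguments are
irrelevant. -/
structure IsKInfty (α : ℝ → ℝ) : Prop where
  continuousOn : ContinuousOn α (Set.Ici 0)
  strictMonoOn : StrictMonoOn α (Set.Ici 0)
  map_zero : α 0 = 0
  tendsto_atTop : Tendsto α atTop atTop

/-- The quadratic form `xᵀ M x`. -/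
def quadForm {d : ℕ} (M : Matrix (Fin d) (Fin d) ℝ) (x : Fin d → ℝ) : ℝ := x ⬝ᵥ (M *ᵥ x)

/-- The squared Euclidean norm `‖x‖² = xᵀ x`. (The norm instance on `Fin d → ℝ` is the sup norm;
it is used below only for square integrability, which does not depend on the choice of norm.) -/
def sqNorm {d : ℕ} (x : Fin d → ℝ) : ℝ := x ⬝ᵥ x

/-- Probability measures on `ℝ^d` with finite second moment. -/
def IsP2 {d : ℕ} (ρ : Measure (Fin d → ℝ)) : Prop :=
  IsProbabilityMeasure ρ ∧ Integrable (fun x => sqNorm x) ρ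

/-- The data of a generalized linear-quadratic stochastic optimal control problem: the dynamics
`f(x,u,w) = A x + B u + E w + z` and the coefficients of the stage cost. -/
structure LQData (n l m : ℕ) where
  A : Matrix (Fin n) (Fin n) ℝ
  B : Matrix (Fin n) (Fin l) ℝ
  E : Matrix (Fin n) (Fin m) ℝ
  z : Fin n → ℝ
  Q₁ : Matrix (Fin n) (Fin n) ℝ
  Q₂ : Matrix (Fin n) (Fin n) ℝ
  R₁ : Matrix (Fin l) (Fin l) ℝ
  R₂ : Matrix (Fin l) (Fin l) ℝ
  s : Fin n → ℝ
  v : Fin l → ℝ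
  c : ℝ

section Prob

variable {Ω : Type*} [MeasurableSpace Ω]

/-- The covariance matrix of a random vector. -/
def covMatrix {d : ℕ} (μ : Measure Ω) (X : Ω → Fin d → ℝ) : Matrix (Fin d) (Fin d) ℝ :=
  Matrix.of fun i j => covariance (fun ω => X ω i) (fun ω => X ω j) μ

namespace LQData

variable {n l m : ℕ} (D : LQData n l m)

/-- The dynamics `f(x,u,w) = A x + B u + E w + z`. -/
def f (x : Fin n → ℝ) (u : Fin l → ℝ) (w : Fin m → ℝ) : Fin n → ℝ :=
  D.A *ᵥ x + D.B *ᵥ u + D.E *ᵥ w + D.z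

/-- The stage cost
`ℓ(X,U) = E[Xᵀ Q₁ X + Uᵀ R₁ U + sᵀ X + vᵀ U + c] + Tr(Q₂ Cov(X)) + Tr(R₂ Cov(U))`. -/
def stageCost (μ : Measure Ω) (X : Ω → Fin n → ℝ) (U : Ω → Fin l → ℝ) : ℝ :=
  (∫ ω, (quadForm D.Q₁ (X ω) + quadForm D.R₁ (U ω) + D.s ⬝ᵥ X ω + D.v ⬝ᵥ U ω + D.c) ∂μ)
    + (Matrix.trace (D.Q₂ * covMatrix μ X) + Matrix.trace (D.R₂ * covMatrix μ U))

/-- The solution `X_U(·, X₀)` of `X(k+1) = f(X(k), U(k), W(k))`, `X(0) = X₀`. -/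
def traj (W : ℕ → Ω → Fin m → ℝ) (X₀ : Ω → Fin n → ℝ) (U : ℕ → Ω → Fin l → ℝ) :
    ℕ → Ω → Fin n → ℝ
  | 0 => X₀
  | k + 1 => fun ω => D.f (traj W X₀ U k ω) (U k ω) (W k ω)

/-- The cost `J_N(X₀, U)`. -/
def cost (μ : Measure Ω) (W : ℕ → Ω → Fin m → ℝ) (N : ℕ) (X₀ : Ω → Fin n → ℝ)
    (U : ℕ → Ω → Fin l → ℝ) : ℝ :=
  ∑ k ∈ Finset.range N, D.stageCost μ (D.traj W X₀ U k) (U k)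

/-- `σ(X(0), …, X(k))`. -/
abbrev pastSigma (X : ℕ → Ω → Fin n → ℝ) (k : ℕ) : MeasurableSpace Ω :=
  ⨆ j ∈ Finset.range (k + 1), MeasurableSpace.comap (X j) inferInstance

/-- `(X, U)` is causal at time `k`: `U(k)` is (up to a null set) a square integrable function
measurable with respect to `σ(X(0), …, X(k))`, and `W(k)` is independent of `X(k)` and
of `U(k)`. -/
structure IsCausalAt (μ : Measure Ω) (W : ℕ → Ω → Fin m → ℝ) (X : ℕ → Ω → Fin n → ℝ)
    (U : ℕ → Ω → Fin l → ℝ) (k : ℕ) : Prop where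
  memLp : MemLp (U k) 2 μ
  adapted : AEStronglyMeasurable[pastSigma X k] (U k) μ
  indep_state : IndepFun (W k) (X k) μ
  indep_control : IndepFun (W k) (U k) μ

/-- `U(0), …, U(N-1)` is an admissible control process for the initial value `X₀` on the
horizon `N`. -/
def IsAdmissible (μ : Measure Ω) (W : ℕ → Ω → Fin m → ℝ) (N : ℕ) (X₀ : Ω → Fin n → ℝ)
    (U : ℕ → Ω → Fin l → ℝ) : Prop :=
  ∀ k < N, IsCausalAt μ W (D.traj W X₀ U) U k

/-- Stationary pairs of state and control processes. -/
structure IsStationaryPair (μ : Measure Ω) (W : ℕ → Ω → Fin m → ℝ) (Xs : ℕ → Ω → Fin n → ℝ)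
    (Us : ℕ → Ω → Fin l → ℝ) : Prop where
  causal : ∀ k, IsCausalAt μ W Xs Us k
  law_state : ∃ ρ : Measure (Fin n → ℝ), IsP2 ρ ∧ ∀ k, HasLaw (Xs k) ρ μ
  law_control : ∃ ρ : Measure (Fin l → ℝ), IsP2 ρ ∧ ∀ k, HasLaw (Us k) ρ μ
  dynamics : ∀ k ω, Xs (k + 1) ω = D.f (Xs k ω) (Us k ω) (W k ω)

/-- Strict dissipativity in `L²` at `(Xs, Us)` with storage function `lam` and comparison
function `α`. The inequality is required for all square integrable `X`, `U` that are
independent of `W(k)`; this includes `X(k)`, `U(k)` for every admissible process. -/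
structure IsStrictlyDissipativeWith (μ : Measure Ω) (W : ℕ → Ω → Fin m → ℝ)
    (Xs : ℕ → Ω → Fin n → ℝ) (Us : ℕ → Ω → Fin l → ℝ)
    (lam : ℕ → (Ω → Fin n → ℝ) → ℝ) (α : ℝ → ℝ) : Prop where
  kInfty : IsKInfty α
  bddBelow : ∃ M : ℝ, ∀ k, ∀ X : Ω → Fin n → ℝ, MemLp X 2 μ → M ≤ lam k X
  dissipation : ∀ k, ∀ (X : Ω → Fin n → ℝ) (U : Ω → Fin l → ℝ),
    MemLp X 2 μ → MemLp U 2 μ → IndepFun (W k) X μ → IndepFun (W k) U μ →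
    α (∫ ω, sqNorm (X ω - Xs k ω) ∂μ) ≤
      D.stageCost μ X U - D.stageCost μ (Xs k) (Us k)
        + lam k X - lam (k + 1) (fun ω => D.f (X ω) (U ω) (W k ω))

/-- The discrete-time algebraic Riccati equation. -/
def IsRiccatiSolution (P : Matrix (Fin n) (Fin n) ℝ) : Prop :=
  P = D.Aᵀ * P * D.A + (D.Q₁ + D.Q₂)
    - D.Aᵀ * P * D.B * ((D.R₁ + D.R₂) + D.Bᵀ * P * D.B)⁻¹ * D.Bᵀ * P * D.A

/-- The gain `K = -[(R₁ + R₂) + Bᵀ P B]⁻¹ Bᵀ P A`. -/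
def gain (P : Matrix (Fin n) (Fin n) ℝ) : Matrix (Fin l) (Fin n) ℝ :=
  -(((D.R₁ + D.R₂) + D.Bᵀ * P * D.B)⁻¹ * D.Bᵀ * P * D.A)

/-- The affine feedback `π(x) = K (x - x̄) + ū` with `K` the gain of `P`. -/
def feedback (P : Matrix (Fin n) (Fin n) ℝ) (xbar : Fin n → ℝ) (ubar : Fin l → ℝ)
    (x : Fin n → ℝ) : Fin l → ℝ :=
  D.gain P *ᵥ (x - xbar) + ubar

/-- The closed-loop state process `X(k+1) = f(X(k), π(X(k)), W(k))`, `X(0) = X₀`. -/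
def closedLoop (W : ℕ → Ω → Fin m → ℝ) (π : (Fin n → ℝ) → (Fin l → ℝ)) (X₀ : Ω → Fin n → ℝ) :
    ℕ → Ω → Fin n → ℝ
  | 0 => X₀
  | k + 1 => fun ω => D.f (closedLoop W π X₀ k ω) (π (closedLoop W π X₀ k ω)) (W k ω)

/-- `ρ` is invariant for the closed loop under `π` with noise distribution `ρW`. -/
def IsInvariant (π : (Fin n → ℝ) → (Fin l → ℝ)) (ρW : Measure (Fin m → ℝ))
    (ρ : Measure (Fin n → ℝ)) : Prop :=
  (ρ.prod ρW).map (fun p => D.f p.1 (π p.1) p.2) = ρ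

/-- The time-varying storage function
`λ(k,X) = E[‖X - (Xs(k) - x̃)‖²_{P+S} - ‖X - xˢ‖²_P + qᵀ (X - (Xs(k) - x̃))]`. -/
def storage (μ : Measure Ω) (P S : Matrix (Fin n) (Fin n) ℝ) (q xs xt : Fin n → ℝ)
    (Xs : ℕ → Ω → Fin n → ℝ) (k : ℕ) (X : Ω → Fin n → ℝ) : ℝ :=
  ∫ ω, (quadForm (P + S) (X ω - (Xs k ω - xt)) - quadForm P (X ω - xs)
    + q ⬝ᵥ (X ω - (Xs k ω - xt))) ∂μ

/-- The mean-square turnpike property at `(Xs, Us)` with comparison function `α`. -/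
def HasMeanSquareTurnpike (μ : Measure Ω) (W : ℕ → Ω → Fin m → ℝ) (Xs : ℕ → Ω → Fin n → ℝ)
    (Us : ℕ → Ω → Fin l → ℝ) (α : ℝ → ℝ) : Prop :=
  ∀ X₀ : Ω → Fin n → ℝ, MemLp X₀ 2 μ → ∃ C : ℝ,
    ∀ (N : ℕ) (δ : ℝ), 0 < δ → ∀ U : ℕ → Ω → Fin l → ℝ, D.IsAdmissible μ W N X₀ U →
      D.cost μ W N X₀ U ≤ δ + ∑ k ∈ Finset.range N, D.stageCost μ (Xs k) (Us k) →
      ∀ ε : ℝ, 0 < ε →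
        (N : ℝ) - (δ + C) / α ε ≤
          (((Finset.range N).filter fun k =>
            ∫ ω, sqNorm (D.traj W X₀ U k ω - Xs k ω) ∂μ ≤ ε).card : ℝ)

end LQData

/-- The probability space is rich enough to carry, for every square integrable distribution on
`ℝⁿ`, an initial value with this distribution that is independent of the whole noise sequence. -/
def CarriesInitialValues {m : ℕ} (n : ℕ) (μ : Measure Ω) (W : ℕ → Ω → Fin m → ℝ) : Prop :=
  ∀ ρ : Measure (Fin n → ℝ), IsP2 ρ →
    ∃ X₀ : Ω → Fin n → ℝ, HasLaw X₀ ρ μ ∧ IndepFun X₀ (fun ω k => W k ω) μ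

end Prob

end

/-! Everything rests on one identity. Centre at the optimal steady state `xe = xt + xs` of the mean
problem with weights `Q₁`, `R₁`; its first order condition, with multiplier `p`, turns the linear
part of the cost into `-p ⬝ᵥ (x - (A x + B u))`. Let `y` be the centred stationary state and `K` the
gain of `P`. By `bellman_eq` and the Riccati equation, cost plus noise-free increment of the
`P`-form is the square of `u - K x` in the metric `R + Bᵀ P B`. For `(x, u)`, `(y, K y)` and the
difference `(x - y, u - K y)` these squares are `Z`, `0` and the same `Z`, so they cancel. Thus the
cost of `(x, u)` minus that of `(y, K y)` is the cost of the difference, up to an increment of `‖x -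
y‖²_P - ‖x‖²_P + ‖y‖²_P`. This dictates the `P`-part of the storage function, while `q` absorbs the
multiplier. Both processes see the same noise, so their difference evolves without noise; the
leftover terms have expectation zero by independence and stationarity (`dissipation_pointwise`,
`dissipation_eq`).

The remaining cost of the difference is coercive. The covariance penalties are nonnegative by
Jensen, and detectability supplies `S` and `c > 0` for which the `Q₁`, `R₁` cost plus the decrease
of the `S`-form dominates `c‖x‖²` (`IsDetectable.exists_storage`, `LQData.le_integral_supply`).
Hence `α r = c * r`. Summation along a trajectory, with the storage function bounded below, gives
the turnpike property.

Existence: `P` is the limit of value iteration from `0`, bounded because of stabilizability. The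
form `P + S` is a strict Lyapunov function for the closed loop although `P` is only semidefinite, so
the linear iteration contracts and a convergent noise series has an invariant law
(`exists_invariant_law`). -/

/-! ### Algebra and bounds for real quadratic forms. -/

section QuadraticForms

variable {d e : ℕ}

theorem sqNorm_eq_sum (x : Fin d → ℝ) : sqNorm x = ∑ i, x i ^ 2 := by
  simp [sqNorm, dotProduct, sq]

theorem sqNorm_nonneg (x : Fin d → ℝ) : 0 ≤ sqNorm x := by
  rw [sqNorm_eq_sum]; positivity

theorem sqNorm_eq_zero {x : Fin d → ℝ} : sqNorm x = 0 ↔ x = 0 :=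
  dotProduct_self_eq_zero

theorem quadForm_zero (M : Matrix (Fin d) (Fin d) ℝ) : quadForm M 0 = 0 := by
  simp [quadForm]

theorem sqNorm_eq_quadForm_one (x : Fin d → ℝ) : sqNorm x = quadForm 1 x := by
  simp [quadForm, sqNorm]

theorem Matrix.IsHermitian.isSymm_real {M : Matrix (Fin d) (Fin d) ℝ} (h : M.IsHermitian) :
    M.IsSymm := by
  rwa [Matrix.IsHermitian, Matrix.conjTranspose_eq_transpose_of_trivial] at h

theorem Matrix.IsSymm.isHermitian_real {M : Matrix (Fin d) (Fin d) ℝ} (h : M.IsSymm) :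
    M.IsHermitian := by
  rwa [Matrix.IsHermitian, Matrix.conjTranspose_eq_transpose_of_trivial]

theorem Matrix.PosSemidef.isSymm_real {M : Matrix (Fin d) (Fin d) ℝ} (h : M.PosSemidef) :
    M.IsSymm := h.isHermitian.isSymm_real

theorem posSemidef_of_quadForm_nonneg {M : Matrix (Fin d) (Fin d) ℝ} (hM : M.IsSymm)
    (h : ∀ x, 0 ≤ quadForm M x) : M.PosSemidef :=
  .of_dotProduct_mulVec_nonneg hM.isHermitian_real fun x => by simpa [quadForm] using h x

theorem Matrix.PosSemidef.quadForm_nonneg {M : Matrix (Fin d) (Fin d) ℝ} (h : M.PosSemidef)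
    (x : Fin d → ℝ) : 0 ≤ quadForm M x := by
  simpa [quadForm] using h.dotProduct_mulVec_nonneg x

theorem dotProduct_mulVec_swap {M : Matrix (Fin d) (Fin d) ℝ} (hM : M.IsSymm)
    (x y : Fin d → ℝ) : x ⬝ᵥ (M *ᵥ y) = y ⬝ᵥ (M *ᵥ x) := by
  rw [Matrix.dotProduct_mulVec, ← Matrix.mulVec_transpose, hM.eq, dotProduct_comm]

theorem quadForm_add {M : Matrix (Fin d) (Fin d) ℝ} (hM : M.IsSymm) (x y : Fin d → ℝ) :
    quadForm M (x + y) = quadForm M x + 2 * (x ⬝ᵥ (M *ᵥ y)) + quadForm M y := by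
  simp only [quadForm, Matrix.mulVec_add, dotProduct_add, add_dotProduct]
  rw [dotProduct_mulVec_swap hM y x]; ring

theorem quadForm_sub {M : Matrix (Fin d) (Fin d) ℝ} (hM : M.IsSymm) (x y : Fin d → ℝ) :
    quadForm M (x - y) = quadForm M x - 2 * (x ⬝ᵥ (M *ᵥ y)) + quadForm M y := by
  simp only [quadForm, Matrix.mulVec_sub, dotProduct_sub, sub_dotProduct]
  rw [dotProduct_mulVec_swap hM y x]; ring

theorem quadForm_smul (M : Matrix (Fin d) (Fin d) ℝ) (c : ℝ) (x : Fin d → ℝ) :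
    quadForm M (c • x) = c ^ 2 * quadForm M x := by
  simp only [quadForm, Matrix.mulVec_smul, dotProduct_smul, smul_dotProduct, smul_eq_mul]; ring

theorem quadForm_add_matrix (M N : Matrix (Fin d) (Fin d) ℝ) (x : Fin d → ℝ) :
    quadForm (M + N) x = quadForm M x + quadForm N x := by
  simp [quadForm, Matrix.add_mulVec, dotProduct_add]

theorem quadForm_sub_matrix (M N : Matrix (Fin d) (Fin d) ℝ) (x : Fin d → ℝ) :
    quadForm (M - N) x = quadForm M x - quadForm N x := by
  simp [quadForm, Matrix.sub_mulVec, dotProduct_sub]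

theorem quadForm_smul_matrix (c : ℝ) (M : Matrix (Fin d) (Fin d) ℝ) (x : Fin d → ℝ) :
    quadForm (c • M) x = c * quadForm M x := by
  simp [quadForm, Matrix.smul_mulVec]

theorem quadForm_transpose_mul_mul (M : Matrix (Fin d) (Fin d) ℝ) (N : Matrix (Fin d) (Fin e) ℝ)
    (x : Fin e → ℝ) : quadForm (Nᵀ * M * N) x = quadForm M (N *ᵥ x) := by
  simp only [quadForm, ← Matrix.mulVec_mulVec]
  rw [Matrix.dotProduct_mulVec, Matrix.vecMul_transpose]

theorem quadForm_transpose_mul_self (N : Matrix (Fin d) (Fin e) ℝ) (x : Fin e → ℝ) :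
    quadForm (Nᵀ * N) x = sqNorm (N *ᵥ x) := by
  rw [sqNorm_eq_quadForm_one, ← quadForm_transpose_mul_mul, Matrix.mul_one]

/-- Young's inequality for a positive semidefinite quadratic form. -/
theorem two_mul_dotProduct_mulVec_le {M : Matrix (Fin d) (Fin d) ℝ} (hM : M.PosSemidef)
    {η : ℝ} (hη : 0 < η) (x y : Fin d → ℝ) :
    2 * (x ⬝ᵥ (M *ᵥ y)) ≤ η * quadForm M x + η⁻¹ * quadForm M y := by
  have h := hM.quadForm_nonneg (η • x - y)
  rw [quadForm_sub hM.isSymm_real, quadForm_smul, smul_dotProduct, smul_eq_mul] at h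
  have h2 := mul_nonneg (inv_pos.2 hη).le h
  have h3 : η⁻¹ * (η ^ 2 * quadForm M x - 2 * (η * (x ⬝ᵥ (M *ᵥ y))) + quadForm M y)
      = η * quadForm M x - 2 * (x ⬝ᵥ (M *ᵥ y)) + η⁻¹ * quadForm M y := by
    field_simp
  linarith

theorem two_mul_dotProduct_le {η : ℝ} (hη : 0 < η) (x y : Fin d → ℝ) :
    2 * (x ⬝ᵥ y) ≤ η * sqNorm x + η⁻¹ * sqNorm y := by
  simpa [sqNorm_eq_quadForm_one] using
    two_mul_dotProduct_mulVec_le (M := 1) Matrix.PosSemidef.one hη x y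

theorem quadForm_add_le {M : Matrix (Fin d) (Fin d) ℝ} (hM : M.PosSemidef)
    {η : ℝ} (hη : 0 < η) (x y : Fin d → ℝ) :
    quadForm M (x + y) ≤ (1 + η) * quadForm M x + (1 + η⁻¹) * quadForm M y := by
  rw [quadForm_add hM.isSymm_real]
  linarith [two_mul_dotProduct_mulVec_le hM hη x y]

/-- The squared Frobenius norm bounds the squared Euclidean operator norm. -/
theorem sqNorm_mulVec_le (M : Matrix (Fin d) (Fin e) ℝ) (x : Fin e → ℝ) :
    sqNorm (M *ᵥ x) ≤ (∑ i, ∑ j, M i j ^ 2) * sqNorm x := by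
  rw [sqNorm_eq_sum, sqNorm_eq_sum, Finset.sum_mul]
  refine Finset.sum_le_sum fun i _ => ?_
  simpa only [Matrix.mulVec, dotProduct] using
    Finset.sum_mul_sq_le_sq_mul_sq Finset.univ (M i) x

theorem exists_sqNorm_mulVec_le (M : Matrix (Fin d) (Fin e) ℝ) :
    ∃ c : ℝ, 0 < c ∧ ∀ x, sqNorm (M *ᵥ x) ≤ c * sqNorm x := by
  refine ⟨(∑ i, ∑ j, M i j ^ 2) + 1, by positivity, fun x => (sqNorm_mulVec_le M x).trans ?_⟩
  nlinarith [sqNorm_nonneg x]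

theorem exists_quadForm_le (M : Matrix (Fin d) (Fin d) ℝ) :
    ∃ c : ℝ, 0 < c ∧ ∀ x, quadForm M x ≤ c * sqNorm x := by
  obtain ⟨c, hc, h⟩ := exists_sqNorm_mulVec_le M
  refine ⟨1 + c, by positivity, fun x => ?_⟩
  have := two_mul_dotProduct_le one_pos x (M *ᵥ x)
  simp only [quadForm]
  nlinarith [h x, sqNorm_nonneg x]

/-- No compactness is needed: Young's inequality for the pair `x`, `M⁻¹ x` bounds `2‖x‖²` by `c`
times the form of `M` plus `c⁻¹` times that of `M⁻¹`, and the latter is at most `‖x‖²`. -/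
theorem Matrix.PosDef.exists_le_quadForm {M : Matrix (Fin d) (Fin d) ℝ} (hM : M.PosDef) :
    ∃ c : ℝ, 0 < c ∧ ∀ x, c * sqNorm x ≤ quadForm M x := by
  obtain ⟨c, hc, h⟩ := exists_quadForm_le M⁻¹
  refine ⟨c⁻¹, by positivity, fun x => ?_⟩
  have hu : IsUnit M.det := (Matrix.isUnit_iff_isUnit_det _).1 hM.isUnit
  have h1 := two_mul_dotProduct_mulVec_le hM.posSemidef hc x (M⁻¹ *ᵥ x)
  have h2 : M *ᵥ (M⁻¹ *ᵥ x) = x := by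
    rw [Matrix.mulVec_mulVec, Matrix.mul_nonsing_inv _ hu, Matrix.one_mulVec]
  have h3 : quadForm M (M⁻¹ *ᵥ x) = quadForm M⁻¹ x := by
    rw [quadForm, h2, dotProduct_comm, quadForm]
  rw [h2, h3] at h1
  have h4 : c⁻¹ * quadForm M⁻¹ x ≤ sqNorm x := by
    rw [inv_mul_le_iff₀ hc]; exact h x
  rw [inv_mul_le_iff₀ hc]
  simp only [sqNorm] at *
  linarith

theorem posDef_of_le_quadForm {M : Matrix (Fin d) (Fin d) ℝ} (hM : M.IsSymm) {c : ℝ} (hc : 0 < c)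
    (h : ∀ x, c * sqNorm x ≤ quadForm M x) : M.PosDef := by
  refine .of_dotProduct_mulVec_pos hM.isHermitian_real fun x hx => ?_
  have h0 : 0 < sqNorm x := (sqNorm_nonneg x).lt_of_ne fun h0 => hx (sqNorm_eq_zero.1 h0.symm)
  have := h x
  simp only [star_trivial]
  exact (mul_pos hc h0).trans_le this

end QuadraticForms

/-! ### Schur stability and Lyapunov functions. -/

section Lyapunov

variable {d : ℕ}

attribute [local instance] Matrix.linftyOpNormedRing Matrix.linftyOpNormedAlgebra

/-- Gelfand's formula: the spectral radius is below some `r < 1`, so eventually `‖a ^ k‖ ≤ r ^ k`,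
and each entry is bounded by the operator norm through its column. -/
theorem IsSchur.tendsto_pow {M : Matrix (Fin d) (Fin d) ℝ} (hM : IsSchur M) (i j : Fin d) :
    Tendsto (fun k => (M ^ k) i j) atTop (nhds 0) := by
  have : Nonempty (Fin d) := ⟨i⟩
  set a : Matrix (Fin d) (Fin d) ℂ := M.map (algebraMap ℝ ℂ) with ha
  have hr : spectralRadius ℂ a < (1 : NNReal) :=
    spectrum.spectralRadius_lt_of_forall_lt a fun z hz => hM z hz
  obtain ⟨r, hr1, hr2⟩ := ENNReal.lt_iff_exists_nnreal_btwn.1 hr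
  have hr2' : r < 1 := by exact_mod_cast hr2
  have hev := (spectrum.pow_nnnorm_pow_one_div_tendsto_nhds_spectralRadius a).eventually_lt_const hr1
  have hle : ∀ᶠ k in atTop, ‖(M ^ k) i j‖ ≤ (r : ℝ) ^ k := by
    filter_upwards [hev, eventually_gt_atTop 0] with k hk hk0
    have h1 : ‖a ^ k‖ ≤ (r : ℝ) ^ k := by
      have h2 : (‖a ^ k‖₊ : ENNReal) ≤ (r : ENNReal) ^ (k : ℝ) := by
        rw [← ENNReal.rpow_inv_le_iff (by positivity), ← one_div]
        exact hk.le
      rw [ENNReal.rpow_natCast] at h2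
      exact_mod_cast h2
    have h3 : (a ^ k) = (M ^ k).map (algebraMap ℝ ℂ) := by
      rw [ha, Matrix.map_pow]
    have h4 := Matrix.linfty_opNorm_mulVec (a ^ k) (Pi.single j 1)
    have h5 := norm_le_pi_norm ((a ^ k) *ᵥ (Pi.single j 1)) i
    rw [Matrix.mulVec_single_one] at h4 h5
    have h6 : ‖(Pi.single j 1 : Fin d → ℂ)‖ ≤ 1 := by
      refine (pi_norm_le_iff_of_nonneg zero_le_one).2 fun b => ?_
      by_cases hb : b = j
      · subst hb; simp
      · simp [Pi.single_eq_of_ne hb]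
    have h7 : ‖(M ^ k) i j‖ = ‖(a ^ k).col j i‖ := by
      simp [h3]
    rw [h7]
    refine h5.trans (h4.trans (le_trans ?_ h1))
    exact mul_le_of_le_one_right (norm_nonneg _) h6
  exact squeeze_zero_norm' hle (tendsto_pow_atTop_nhds_zero_of_lt_one r.2 (by exact_mod_cast hr2'))

/-- A Schur stable matrix admits a quadratic Lyapunov function. -/
theorem IsSchur.exists_lyapunov {M : Matrix (Fin d) (Fin d) ℝ} (hM : IsSchur M) :
    ∃ S : Matrix (Fin d) (Fin d) ℝ, S.PosDef ∧
      ∀ x, quadForm S (M *ᵥ x) + 1 / 2 * sqNorm x ≤ quadForm S x := by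
  have ht : Tendsto (fun k => ∑ i, ∑ j, (M ^ k) i j ^ 2) atTop (nhds 0) := by
    have := tendsto_finsetSum Finset.univ fun i _ =>
      tendsto_finsetSum Finset.univ fun j _ => (hM.tendsto_pow i j).pow 2
    simpa using this
  -- A truncated Lyapunov series suffices: telescoping leaves `‖M ^ N x‖² - ‖x‖²`, at most `-‖x‖² /
  -- 2` once the squared Frobenius norm of `M ^ N` is below `1 / 2`. With `N > 0` the term `k = 0`
  -- makes `S` positive definite.
  obtain ⟨N, hN, hN0⟩ := ((ht.eventually_lt_const (show (0 : ℝ) < 1 / 2 by norm_num)).and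
    (eventually_gt_atTop 0)).exists
  set S : Matrix (Fin d) (Fin d) ℝ := ∑ k ∈ Finset.range N, (M ^ k)ᵀ * M ^ k with hS
  have hq : ∀ x, quadForm S x = ∑ k ∈ Finset.range N, sqNorm (M ^ k *ᵥ x) := by
    intro x
    simp only [← quadForm_transpose_mul_self]
    simp only [quadForm, hS, Matrix.sum_mulVec, dotProduct_sum]
  have hsymm : S.IsSymm := by
    simp [Matrix.IsSymm, hS, Matrix.transpose_sum, Matrix.transpose_mul]
  refine ⟨S, posDef_of_le_quadForm hsymm one_pos fun x => ?_, fun x => ?_⟩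
  · rw [hq, one_mul]
    have := Finset.single_le_sum (f := fun k => sqNorm (M ^ k *ᵥ x))
      (fun k _ => sqNorm_nonneg _) (Finset.mem_range.2 hN0)
    simpa using this
  · rw [hq, hq]
    have h1 : ∀ k, sqNorm (M ^ k *ᵥ (M *ᵥ x)) = sqNorm (M ^ (k + 1) *ᵥ x) := fun k => by
      rw [Matrix.mulVec_mulVec, pow_succ]
    simp only [h1]
    have h2 := Finset.sum_range_sub (fun k => sqNorm (M ^ k *ᵥ x)) N
    rw [Finset.sum_sub_distrib] at h2
    have h3 := sqNorm_mulVec_le (M ^ N) x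
    have h4 := sqNorm_nonneg x
    simp only [pow_zero, Matrix.one_mulVec] at h2
    nlinarith

end Lyapunov

/-! ### Detectability as a dissipation inequality. -/

section Detectability

variable {n l : ℕ}

/-- Detectability through the square root of `Q` yields an input-to-state type Lyapunov function
whose increase is dominated by the stage cost. -/
theorem IsDetectable.exists_storage {A : Matrix (Fin n) (Fin n) ℝ} (B : Matrix (Fin n) (Fin l) ℝ)
    {Q : Matrix (Fin n) (Fin n) ℝ} {R : Matrix (Fin l) (Fin l) ℝ} (hQ : Q.PosSemidef)
    (hR : R.PosDef) (h : IsDetectable A (CFC.sqrt Q)) :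
    ∃ S : Matrix (Fin n) (Fin n) ℝ, S.PosDef ∧ ∃ c : ℝ, 0 < c ∧ ∀ x u,
      c * sqNorm x + quadForm S (A *ᵥ x + B *ᵥ u)
        ≤ quadForm Q x + quadForm R u + quadForm S x := by
  obtain ⟨L, hL⟩ := h
  obtain ⟨S, hS, hLyap⟩ := hL.exists_lyapunov
  set C := CFC.sqrt Q with hC
  have hCs : C.IsSymm := by
    have : (0 : Matrix (Fin n) (Fin n) ℝ) ≤ C := CFC.sqrt_nonneg Q
    exact (Matrix.nonneg_iff_posSemidef.1 this).isSymm_real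
  have hCQ : ∀ x, sqNorm (C *ᵥ x) = quadForm Q x := by
    intro x
    rw [← quadForm_transpose_mul_self, hCs.eq, hC,
      CFC.sqrt_mul_sqrt_self Q (Matrix.nonneg_iff_posSemidef.2 hQ)]
  obtain ⟨r, hr, hRr⟩ := hR.exists_le_quadForm
  obtain ⟨s, hs, hSs⟩ := exists_quadForm_le S
  obtain ⟨b, hb, hBb⟩ := exists_sqNorm_mulVec_le B
  obtain ⟨t, ht, hLt⟩ := exists_sqNorm_mulVec_le L
  -- The Lyapunov function of `A + L C` provides a decrease of `‖x‖² / 2`; this `η` spends half of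
  -- it on the Young cross term. The constant `κ` collects the cost of the perturbation and is
  -- divided out at the end by rescaling `S`.
  set η : ℝ := (4 * s)⁻¹ with hη
  have hη0 : 0 < η := by positivity
  have hηs : η * s = 1 / 4 := by rw [hη]; field_simp
  set κ : ℝ := (1 + η⁻¹) * (2 * s) * (t + b * r⁻¹) with hκ
  have hκ0 : 0 < κ := by positivity
  have key : ∀ x u, 1 / 4 * sqNorm x + quadForm S (A *ᵥ x + B *ᵥ u)
      ≤ κ * (quadForm Q x + quadForm R u) + quadForm S x := by
    intro x u
    -- Output injection: the perturbation involves only `u` and `C x`, both controlled by the stage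
    -- cost.
    have e : A *ᵥ x + B *ᵥ u = (A + L * C) *ᵥ x + (B *ᵥ u - L *ᵥ (C *ᵥ x)) := by
      rw [Matrix.add_mulVec, Matrix.mulVec_mulVec]; abel
    have h1 := quadForm_add_le hS.posSemidef hη0 ((A + L * C) *ᵥ x) (B *ᵥ u - L *ᵥ (C *ᵥ x))
    rw [← e] at h1
    have h2 := hLyap x
    have h3 := sqNorm_nonneg x
    have h4 : η * quadForm S ((A + L * C) *ᵥ x) ≤ 1 / 4 * sqNorm x := by
      rw [← hηs, mul_assoc]
      exact mul_le_mul_of_nonneg_left (by linarith [hSs x]) hη0.le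
    have h5 : sqNorm (B *ᵥ u - L *ᵥ (C *ᵥ x)) ≤
        2 * sqNorm (B *ᵥ u) + 2 * sqNorm (L *ᵥ (C *ᵥ x)) := by
      have h := quadForm_add_le (M := 1) Matrix.PosSemidef.one one_pos (B *ᵥ u)
        ((-1 : ℝ) • (L *ᵥ (C *ᵥ x)))
      rw [quadForm_smul, neg_one_smul, ← sub_eq_add_neg] at h
      simp only [← sqNorm_eq_quadForm_one] at h
      norm_num at h ⊢
      linarith
    have h6 := hBb u
    have h7 := hLt (C *ᵥ x)
    rw [hCQ] at h7
    have hq := hQ.quadForm_nonneg x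
    have hr' := hR.posSemidef.quadForm_nonneg u
    have h8 : sqNorm u ≤ r⁻¹ * quadForm R u := by
      rw [← div_eq_inv_mul, le_div_iff₀ hr]; linarith [hRr u]
    have h9 : sqNorm (B *ᵥ u) ≤ b * r⁻¹ * quadForm R u := by
      rw [mul_assoc]; exact h6.trans (mul_le_mul_of_nonneg_left h8 hb.le)
    have h10 : sqNorm (B *ᵥ u - L *ᵥ (C *ᵥ x)) ≤
        2 * ((t + b * r⁻¹) * (quadForm Q x + quadForm R u)) := by
      have p1 : 0 ≤ t * quadForm R u := mul_nonneg ht.le hr'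
      have p2 : 0 ≤ b * r⁻¹ * quadForm Q x := mul_nonneg (by positivity) hq
      linarith
    have h11 : (1 + η⁻¹) * quadForm S (B *ᵥ u - L *ᵥ (C *ᵥ x)) ≤
        κ * (quadForm Q x + quadForm R u) := by
      have : κ * (quadForm Q x + quadForm R u) =
          (1 + η⁻¹) * (s * (2 * ((t + b * r⁻¹) * (quadForm Q x + quadForm R u)))) := by
        rw [hκ]; ring
      rw [this]
      refine mul_le_mul_of_nonneg_left ((hSs _).trans ?_) (by positivity)
      exact mul_le_mul_of_nonneg_left h10 hs.le
    linarith
  refine ⟨κ⁻¹ • S, hS.smul (inv_pos.2 hκ0), κ⁻¹ * (1 / 4), by positivity, fun x u => ?_⟩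
  rw [quadForm_smul_matrix, quadForm_smul_matrix]
  have := mul_le_mul_of_nonneg_left (key x u) (inv_pos.2 hκ0).le
  rw [mul_add, mul_add, inv_mul_cancel_left₀ hκ0.ne'] at this
  linarith

end Detectability

/-! ### The Riccati operator and value iteration. -/

section Riccati

variable {n l : ℕ} (A : Matrix (Fin n) (Fin n) ℝ) (B : Matrix (Fin n) (Fin l) ℝ)
  (Q : Matrix (Fin n) (Fin n) ℝ) (R : Matrix (Fin l) (Fin l) ℝ)

/-- The Riccati operator. -/
noncomputable def riccatiMap (P : Matrix (Fin n) (Fin n) ℝ) : Matrix (Fin n) (Fin n) ℝ :=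
  Aᵀ * P * A + Q - Aᵀ * P * B * (R + Bᵀ * P * B)⁻¹ * Bᵀ * P * A

/-- The minimizing gain of the Riccati operator. -/
noncomputable def riccatiGain (P : Matrix (Fin n) (Fin n) ℝ) : Matrix (Fin l) (Fin n) ℝ :=
  -((R + Bᵀ * P * B)⁻¹ * Bᵀ * P * A)

variable {A B Q R}

theorem posDef_add_transpose_mul_mul {P : Matrix (Fin n) (Fin n) ℝ} (hP : P.PosSemidef)
    (hR : R.PosDef) : (R + Bᵀ * P * B).PosDef := by
  refine hR.add_posSemidef ?_
  simpa using hP.conjTranspose_mul_mul_same B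

theorem riccatiMap_isSymm {P : Matrix (Fin n) (Fin n) ℝ} (hP : P.PosSemidef) (hQ : Q.PosSemidef)
    (hR : R.PosDef) : (riccatiMap A B Q R P).IsSymm := by
  have h1 := hP.isSymm_real.eq
  have h2 := hQ.isSymm_real.eq
  have h3 := (posDef_add_transpose_mul_mul (B := B) hP hR).posSemidef.isSymm_real.eq
  rw [Matrix.IsSymm, riccatiMap, Matrix.transpose_sub, Matrix.transpose_add]
  simp only [Matrix.transpose_mul, Matrix.transpose_nonsing_inv, Matrix.transpose_transpose, h1, h2]
  rw [h3]
  simp only [Matrix.mul_assoc]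

/-- Completing the square in the Bellman operator. -/
theorem bellman_eq {P : Matrix (Fin n) (Fin n) ℝ} (hP : P.PosSemidef) (hR : R.PosDef)
    (x : Fin n → ℝ) (u : Fin l → ℝ) :
    quadForm P (A *ᵥ x + B *ᵥ u) + quadForm Q x + quadForm R u
      = quadForm (riccatiMap A B Q R P) x
        + quadForm (R + Bᵀ * P * B) (u - riccatiGain A B R P *ᵥ x) := by
  set M := R + Bᵀ * P * B with hM
  have hMpd : M.PosDef := posDef_add_transpose_mul_mul hP hR
  have hMu : IsUnit M.det := (Matrix.isUnit_iff_isUnit_det _).1 hMpd.isUnit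
  set g : Fin l → ℝ := Bᵀ *ᵥ (P *ᵥ (A *ᵥ x)) with hg
  have hK : riccatiGain A B R P *ᵥ x = -(M⁻¹ *ᵥ g) := by
    simp only [riccatiGain, Matrix.neg_mulVec, ← Matrix.mulVec_mulVec, ← hM, hg]
  have hMg : M *ᵥ (M⁻¹ *ᵥ g) = g := by
    rw [Matrix.mulVec_mulVec, Matrix.mul_nonsing_inv _ hMu, Matrix.one_mulVec]
  have h1 : quadForm M u = quadForm R u + quadForm P (B *ᵥ u) := by
    rw [hM, quadForm_add_matrix, quadForm_transpose_mul_mul]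
  have h2 : (A *ᵥ x) ⬝ᵥ (P *ᵥ (B *ᵥ u)) = u ⬝ᵥ g := by
    rw [dotProduct_mulVec_swap hP.isSymm_real, hg, Matrix.dotProduct_mulVec u,
      Matrix.vecMul_transpose]
  have h3 : quadForm (riccatiMap A B Q R P) x
      = quadForm P (A *ᵥ x) + quadForm Q x - g ⬝ᵥ (M⁻¹ *ᵥ g) := by
    rw [riccatiMap, quadForm_sub_matrix, quadForm_add_matrix, quadForm_transpose_mul_mul, ← hM]
    congr 1
    simp only [quadForm, ← Matrix.mulVec_mulVec, ← hg]
    rw [Matrix.dotProduct_mulVec x, Matrix.vecMul_transpose,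
      dotProduct_mulVec_swap hP.isSymm_real, dotProduct_comm, Matrix.dotProduct_mulVec,
      ← Matrix.mulVec_transpose, ← hg]
  rw [quadForm_add hP.isSymm_real, h2, h3, hK, sub_neg_eq_add,
    quadForm_add hMpd.posSemidef.isSymm_real, hMg, h1]
  have h4 : quadForm M (M⁻¹ *ᵥ g) = g ⬝ᵥ (M⁻¹ *ᵥ g) := by
    rw [quadForm, hMg, dotProduct_comm]
  rw [h4]; ring

theorem riccatiMap_posSemidef {P : Matrix (Fin n) (Fin n) ℝ} (hP : P.PosSemidef)
    (hQ : Q.PosSemidef) (hR : R.PosDef) : (riccatiMap A B Q R P).PosSemidef := by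
  refine posSemidef_of_quadForm_nonneg (riccatiMap_isSymm hP hQ hR) fun x => ?_
  have h := bellman_eq (A := A) (B := B) (Q := Q) hP hR x (riccatiGain A B R P *ᵥ x)
  rw [sub_self, quadForm_zero, add_zero] at h
  rw [← h]
  linarith [hP.quadForm_nonneg (A *ᵥ x + B *ᵥ (riccatiGain A B R P *ᵥ x)), hQ.quadForm_nonneg x,
    hR.posSemidef.quadForm_nonneg (riccatiGain A B R P *ᵥ x)]

theorem quadForm_riccatiMap_le {P : Matrix (Fin n) (Fin n) ℝ} (hP : P.PosSemidef) (hR : R.PosDef)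
    (x : Fin n → ℝ) (u : Fin l → ℝ) :
    quadForm (riccatiMap A B Q R P) x
      ≤ quadForm P (A *ᵥ x + B *ᵥ u) + quadForm Q x + quadForm R u := by
  rw [bellman_eq hP hR]
  linarith [(posDef_add_transpose_mul_mul (B := B) hP hR).posSemidef.quadForm_nonneg
    (u - riccatiGain A B R P *ᵥ x)]

/-- The operator is a minimum over `u` of expressions monotone in `P`; inserting the minimizer for
`P'` compares the two minima. -/
theorem quadForm_riccatiMap_mono {P P' : Matrix (Fin n) (Fin n) ℝ} (hP : P.PosSemidef)
    (hP' : P'.PosSemidef) (hR : R.PosDef) (h : ∀ x, quadForm P x ≤ quadForm P' x)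
    (x : Fin n → ℝ) :
    quadForm (riccatiMap A B Q R P) x ≤ quadForm (riccatiMap A B Q R P') x := by
  have h' := bellman_eq (A := A) (B := B) (Q := Q) hP' hR x (riccatiGain A B R P' *ᵥ x)
  rw [sub_self, quadForm_zero, add_zero] at h'
  rw [← h']
  exact (quadForm_riccatiMap_le hP hR x _).trans (by gcongr; exact h _)

theorem continuousAt_riccatiMap {P : Matrix (Fin n) (Fin n) ℝ} (hP : P.PosSemidef)
    (hR : R.PosDef) : ContinuousAt (riccatiMap A B Q R) P := by
  have hM := (posDef_add_transpose_mul_mul (B := B) hP hR).det_pos.ne'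
  have h1 : ContinuousAt (fun P : Matrix (Fin n) (Fin n) ℝ => (R + Bᵀ * P * B)⁻¹) P := by
    refine ContinuousAt.comp (f := fun P : Matrix (Fin n) (Fin n) ℝ => R + Bᵀ * P * B)
      (continuousAt_matrix_inv _ ?_) ?_
    · simpa only [Ring.inverse_eq_inv'] using continuousAt_inv₀ hM
    · exact Continuous.continuousAt (by fun_prop)
  have h2 : ∀ (a b c : ℕ) (F : Matrix (Fin n) (Fin n) ℝ → Matrix (Fin a) (Fin b) ℝ)
      (G : Matrix (Fin n) (Fin n) ℝ → Matrix (Fin b) (Fin c) ℝ), ContinuousAt F P →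
      ContinuousAt G P → ContinuousAt (fun P => F P * G P) P := fun a b c F G hF hG =>
    (Continuous.matrix_mul continuous_fst continuous_snd).continuousAt.comp (hF.prodMk hG)
  have hid : ContinuousAt (fun P : Matrix (Fin n) (Fin n) ℝ => P) P := continuousAt_id
  unfold riccatiMap
  refine ContinuousAt.sub (Continuous.continuousAt (by fun_prop)) ?_
  refine h2 _ _ _ _ _ (h2 _ _ _ _ _ (h2 _ _ _ _ _ (h2 _ _ _ _ _ ?_ h1) continuousAt_const) hid)
    continuousAt_const
  exact Continuous.continuousAt (by fun_prop)

theorem entry_eq_polarization {M : Matrix (Fin n) (Fin n) ℝ} (hM : M.IsSymm) (i j : Fin n) :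
    M i j = (quadForm M (Pi.single i 1 + Pi.single j 1) - quadForm M (Pi.single i 1)
      - quadForm M (Pi.single j 1)) / 2 := by
  rw [quadForm_add hM]
  simp
  ring

/-- A monotone bounded sequence of positive semidefinite matrices converges. -/
theorem exists_tendsto_of_monotone_posSemidef {P : ℕ → Matrix (Fin n) (Fin n) ℝ}
    (hP : ∀ k, (P k).PosSemidef) (hmono : ∀ x, Monotone fun k => quadForm (P k) x)
    (hbdd : ∀ x, BddAbove (Set.range fun k => quadForm (P k) x)) :
    ∃ P' : Matrix (Fin n) (Fin n) ℝ, P'.PosSemidef ∧ Tendsto P atTop (nhds P') := by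
  have hlim : ∀ x, ∃ a, Tendsto (fun k => quadForm (P k) x) atTop (nhds a) := fun x =>
    ⟨_, tendsto_atTop_ciSup (hmono x) (hbdd x)⟩
  choose a ha using hlim
  -- Convergence is known only for the values of the forms; polarization recovers the entries.
  set P' : Matrix (Fin n) (Fin n) ℝ := Matrix.of fun i j =>
    (a (Pi.single i 1 + Pi.single j 1) - a (Pi.single i 1) - a (Pi.single j 1)) / 2 with hP'
  have ht : Tendsto P atTop (nhds P') := by
    refine tendsto_pi_nhds.2 fun i => tendsto_pi_nhds.2 fun j => ?_
    have := (((ha (Pi.single i 1 + Pi.single j 1)).sub (ha (Pi.single i 1))).sub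
      (ha (Pi.single j 1))).div_const 2
    refine this.congr fun k => ?_
    rw [← entry_eq_polarization (hP k).isSymm_real]
  have hsymm : P'.IsSymm := by
    refine tendsto_nhds_unique ((Continuous.matrix_transpose continuous_id).continuousAt.tendsto.comp
      ht) (ht.congr fun k => ?_)
    exact ((hP k).isSymm_real.eq).symm
  refine ⟨P', posSemidef_of_quadForm_nonneg hsymm fun x => ?_, ht⟩
  have hc : Continuous fun M : Matrix (Fin n) (Fin n) ℝ => quadForm M x := by
    unfold quadForm; fun_prop
  exact ge_of_tendsto' (hc.continuousAt.tendsto.comp ht) fun k => (hP k).quadForm_nonneg x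

/-- Stabilizability gives an upper bound for the value iteration. -/
theorem IsStabilizable.exists_riccati_bound (hAB : IsStabilizable A B) :
    ∃ (F : Matrix (Fin l) (Fin n) ℝ) (T : Matrix (Fin n) (Fin n) ℝ), T.PosSemidef ∧
      ∀ x, quadForm T (A *ᵥ x + B *ᵥ (F *ᵥ x)) + quadForm Q x + quadForm R (F *ᵥ x)
        ≤ quadForm T x := by
  obtain ⟨F, hF⟩ := hAB
  obtain ⟨S, hS, hL⟩ := hF.exists_lyapunov
  obtain ⟨c, hc, hle⟩ := exists_quadForm_le (Q + Fᵀ * R * F)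
  -- The factor `2` compensates the decrease of only `‖x‖² / 2` in `IsSchur.exists_lyapunov`; `c`
  -- bounds the running cost under `u = F x`.
  refine ⟨F, (2 * c) • S, hS.posSemidef.smul (by positivity), fun x => ?_⟩
  have h1 := hL x
  have h2 := hle x
  rw [Matrix.add_mulVec, ← Matrix.mulVec_mulVec] at h1
  rw [quadForm_add_matrix, quadForm_transpose_mul_mul] at h2
  rw [quadForm_smul_matrix, quadForm_smul_matrix]
  nlinarith

/-- Existence of a positive semidefinite solution of the algebraic Riccati equation. -/
theorem IsStabilizable.exists_riccati (hAB : IsStabilizable A B) (hQ : Q.PosSemidef)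
    (hR : R.PosDef) :
    ∃ P : Matrix (Fin n) (Fin n) ℝ, P.PosSemidef ∧ P = riccatiMap A B Q R P := by
  obtain ⟨F, T, hT, hFT⟩ := hAB.exists_riccati_bound (Q := Q) (R := R)
  -- Value iteration starts at `0`, which lies below both its first iterate and `T`; monotonicity of
  -- the operator propagates both comparisons.
  set it : ℕ → Matrix (Fin n) (Fin n) ℝ := fun k => (riccatiMap A B Q R)^[k] 0 with hit
  have hsucc : ∀ k, it (k + 1) = riccatiMap A B Q R (it k) := fun k =>
    Function.iterate_succ_apply' _ _ _
  have hpsd : ∀ k, (it k).PosSemidef := by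
    intro k
    induction k with
    | zero => exact Matrix.PosSemidef.zero
    | succ k ih => rw [hsucc]; exact riccatiMap_posSemidef ih hQ hR
  have hmono : ∀ k x, quadForm (it k) x ≤ quadForm (it (k + 1)) x := by
    intro k
    induction k with
    | zero =>
      intro x
      have : quadForm (it 0) x = 0 := by simp [hit, quadForm]
      rw [this]; exact (hpsd 1).quadForm_nonneg x
    | succ k ih =>
      intro x
      rw [hsucc, hsucc (k + 1)]
      exact quadForm_riccatiMap_mono (hpsd _) (hpsd _) hR ih x
  have hbd : ∀ k x, quadForm (it k) x ≤ quadForm T x := by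
    intro k
    induction k with
    | zero =>
      intro x
      have : quadForm (it 0) x = 0 := by simp [hit, quadForm]
      rw [this]; exact hT.quadForm_nonneg x
    | succ k ih =>
      intro x
      rw [hsucc]
      refine (quadForm_riccatiMap_le (hpsd k) hR x (F *ᵥ x)).trans (le_trans ?_ (hFT x))
      gcongr
      exact ih _
  obtain ⟨P, hP, ht⟩ := exists_tendsto_of_monotone_posSemidef hpsd
    (fun x => monotone_nat_of_le_succ fun k => hmono k x)
    (fun x => ⟨quadForm T x, by rintro _ ⟨k, rfl⟩; exact hbd k x⟩)
  refine ⟨P, hP, tendsto_nhds_unique ((tendsto_add_atTop_iff_nat 1).2 ht) ?_⟩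
  simp only [hsucc]
  exact (continuousAt_riccatiMap hP hR).tendsto.comp ht

end Riccati

/-! ### The optimal steady state and its Lagrange multiplier. -/

section Multiplier

variable {n l : ℕ} {A : Matrix (Fin n) (Fin n) ℝ} {B : Matrix (Fin n) (Fin l) ℝ}
  {Q : Matrix (Fin n) (Fin n) ℝ} {R : Matrix (Fin l) (Fin l) ℝ}

/-- First order optimality conditions for the minimization of a quadratic cost over the steady
states `x = A x + B u`: existence of a solution and of a Lagrange multiplier. -/
theorem exists_optimal_steadyState (hQ : Q.PosSemidef) (hR : R.PosDef)
    (hinj : ∀ x u, x = A *ᵥ x + B *ᵥ u → quadForm Q x + quadForm R u = 0 → x = 0)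
    (g : Fin n → ℝ) (h : Fin l → ℝ) :
    ∃ (x₀ : Fin n → ℝ) (u₀ : Fin l → ℝ) (p : Fin n → ℝ), x₀ = A *ᵥ x₀ + B *ᵥ u₀ ∧
      ∀ x u, 2 * (x ⬝ᵥ (Q *ᵥ x₀)) + 2 * (u ⬝ᵥ (R *ᵥ u₀)) + g ⬝ᵥ x + h ⬝ᵥ u
        + p ⬝ᵥ (x - (A *ᵥ x + B *ᵥ u)) = 0 := by
  let G : (Fin n → ℝ) × (Fin l → ℝ) →ₗ[ℝ] (Fin n → ℝ) :=
    LinearMap.fst ℝ _ _ - (A.mulVecLin ∘ₗ LinearMap.fst ℝ _ _ + B.mulVecLin ∘ₗ LinearMap.snd ℝ _ _)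
  have hG : ∀ y : (Fin n → ℝ) × (Fin l → ℝ), G y = y.1 - (A *ᵥ y.1 + B *ᵥ y.2) := fun y => rfl
  have hker : ∀ y : (Fin n → ℝ) × (Fin l → ℝ), y ∈ G.ker ↔ y.1 = A *ᵥ y.1 + B *ᵥ y.2 := fun y => by
    rw [LinearMap.mem_ker, hG, sub_eq_zero]
  let H : (Fin n → ℝ) × (Fin l → ℝ) →ₗ[ℝ] (Fin n → ℝ) × (Fin l → ℝ) →ₗ[ℝ] ℝ := LinearMap.mk₂ ℝ
    (fun y y' => 2 * (y'.1 ⬝ᵥ (Q *ᵥ y.1)) + 2 * (y'.2 ⬝ᵥ (R *ᵥ y.2)))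
    (fun a b c => by simp [Matrix.mulVec_add]; ring)
    (fun a b c => by simp [Matrix.mulVec_smul]; ring)
    (fun a b c => by simp; ring)
    (fun a b c => by simp; ring)
  -- The Hessian of the cost restricted to the steady states. It is definite there, hence injective,
  -- and in finite dimension onto the dual, so the restricted gradient vanishes at some point.
  let L : G.ker →ₗ[ℝ] Module.Dual ℝ G.ker :=
    (LinearMap.lcomp ℝ ℝ G.ker.subtype) ∘ₗ H ∘ₗ G.ker.subtype
  have hL : ∀ y y' : G.ker, L y y' = 2 * (y'.1.1 ⬝ᵥ (Q *ᵥ y.1.1)) + 2 * (y'.1.2 ⬝ᵥ (R *ᵥ y.1.2)) :=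
    fun y y' => rfl
  have hLinj : Function.Injective L := by
    rw [← LinearMap.ker_eq_bot, LinearMap.ker_eq_bot']
    intro y hy
    have h0 : L y y = 0 := by rw [hy]; rfl
    rw [hL] at h0
    have hq := hQ.quadForm_nonneg y.1.1
    have hr := hR.posSemidef.quadForm_nonneg y.1.2
    have hsum : quadForm Q y.1.1 + quadForm R y.1.2 = 0 := by
      simp only [quadForm]; linarith
    have hx := hinj _ _ ((hker _).1 y.2) hsum
    obtain ⟨c, hc, hcR⟩ := hR.exists_le_quadForm
    have hu : y.1.2 = 0 := by
      refine sqNorm_eq_zero.1 (le_antisymm ?_ (sqNorm_nonneg _))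
      have := hcR y.1.2
      by_contra hcon
      push Not at hcon
      nlinarith [mul_pos hc hcon]
    exact Subtype.ext (Prod.ext hx hu)
  have hLsurj : Function.Surjective L :=
    (LinearMap.injective_iff_surjective_of_finrank_eq_finrank
      (Subspace.dual_finrank_eq (K := ℝ) (V := G.ker)).symm).1 hLinj
  let φ : (Fin n → ℝ) × (Fin l → ℝ) →ₗ[ℝ] ℝ := LinearMap.coprod (dotProductBilin ℝ ℝ g) (dotProductBilin ℝ ℝ h)
  have hφ : ∀ y : (Fin n → ℝ) × (Fin l → ℝ), φ y = g ⬝ᵥ y.1 + h ⬝ᵥ y.2 := fun y => rfl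
  obtain ⟨y₀, hy₀⟩ := hLsurj (-(φ.domRestrict G.ker))
  -- The full gradient annihilates `G.ker`, so it factors through `G`; minus the factor is the
  -- multiplier.
  have hann : H y₀.1 + φ ∈ (G.ker).dualAnnihilator := by
    rw [Submodule.mem_dualAnnihilator]
    intro w hw
    have := LinearMap.congr_fun hy₀ ⟨w, hw⟩
    change H y₀.1 w = -(φ w) at this
    rw [LinearMap.add_apply, this]; ring
  rw [← LinearMap.range_dualMap_eq_dualAnnihilator_ker] at hann
  obtain ⟨ψ, hψ⟩ := hann
  refine ⟨y₀.1.1, y₀.1.2, -(fun i => ψ (Pi.single i 1)), (hker _).1 y₀.2, fun x u => ?_⟩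
  have h1 := LinearMap.congr_fun hψ (x, u)
  change ψ (G (x, u)) = H y₀.1 (x, u) + φ (x, u) at h1
  have h2 : ∀ z : Fin n → ℝ, ψ z = (fun i => ψ (Pi.single i 1)) ⬝ᵥ z := by
    intro z
    conv_lhs => rw [pi_eq_sum_univ' z]
    simp [dotProduct, mul_comm]
  rw [h2, hG, hφ] at h1
  change _ = 2 * (x ⬝ᵥ (Q *ᵥ y₀.1.1)) + 2 * (u ⬝ᵥ (R *ᵥ y₀.1.2)) + _ at h1
  rw [neg_dotProduct, h1]
  simp only
  ring

end Multiplier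

/-! ### Integrals of linear and quadratic expressions in random vectors. -/

section SquareIntegrable

variable {Ω : Type*} [MeasurableSpace Ω] {μ : Measure Ω} {d e : ℕ}

theorem MeasureTheory.Integrable.fun_sub {f g : Ω → ℝ} (hf : Integrable f μ)
    (hg : Integrable g μ) : Integrable (fun ω => f ω - g ω) μ :=
  hf.sub hg

theorem continuous_sqNorm : Continuous (sqNorm : (Fin d → ℝ) → ℝ) := by
  unfold sqNorm; fun_prop

theorem MeasureTheory.MemLp.integrable_dotProduct {X Y : Ω → Fin d → ℝ} (hX : MemLp X 2 μ)
    (hY : MemLp Y 2 μ) : Integrable (fun ω => X ω ⬝ᵥ Y ω) μ := by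
  simp only [dotProduct]
  exact integrable_finsetSum _ fun i _ => (hX.eval i).integrable_mul (hY.eval i)

theorem memLp_two_iff_integrable_sqNorm {X : Ω → Fin d → ℝ} (hX : AEStronglyMeasurable X μ) :
    MemLp X 2 μ ↔ Integrable (fun ω => sqNorm (X ω)) μ := by
  refine ⟨fun h => h.integrable_dotProduct h, fun h => memLp_pi_iff.2 fun i => ?_⟩
  have hi : AEStronglyMeasurable (fun ω => X ω i) μ :=
    (continuous_apply i).comp_aestronglyMeasurable hX
  rw [memLp_two_iff_integrable_sq hi]
  refine h.mono' (hi.pow 2) (Eventually.of_forall fun ω => ?_)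
  rw [Real.norm_of_nonneg (sq_nonneg _), sqNorm_eq_sum]
  exact Finset.single_le_sum (f := fun i => X ω i ^ 2) (fun _ _ => sq_nonneg _)
    (Finset.mem_univ i)

theorem MeasureTheory.MemLp.mulVec (M : Matrix (Fin e) (Fin d) ℝ) {X : Ω → Fin d → ℝ}
    (hX : MemLp X 2 μ) : MemLp (fun ω => M *ᵥ X ω) 2 μ :=
  (LinearMap.toContinuousLinearMap M.mulVecLin).comp_memLp' hX

theorem MeasureTheory.MemLp.integrable_quadForm (M : Matrix (Fin d) (Fin d) ℝ)
    {X : Ω → Fin d → ℝ} (hX : MemLp X 2 μ) : Integrable (fun ω => quadForm M (X ω)) μ :=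
  hX.integrable_dotProduct (hX.mulVec M)

theorem integral_mulVec (M : Matrix (Fin e) (Fin d) ℝ) {X : Ω → Fin d → ℝ}
    (hX : Integrable X μ) : ∫ ω, M *ᵥ X ω ∂μ = M *ᵥ ∫ ω, X ω ∂μ :=
  (LinearMap.toContinuousLinearMap M.mulVecLin).integral_comp_comm hX

theorem MeasureTheory.Integrable.const_dotProduct (a : Fin d → ℝ) {X : Ω → Fin d → ℝ}
    (hX : Integrable X μ) : Integrable (fun ω => a ⬝ᵥ X ω) μ :=
  (LinearMap.toContinuousLinearMap (dotProductBilin ℝ ℝ a)).integrable_comp hX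

theorem integral_const_dotProduct (a : Fin d → ℝ) {X : Ω → Fin d → ℝ}
    (hX : Integrable X μ) : ∫ ω, a ⬝ᵥ X ω ∂μ = a ⬝ᵥ ∫ ω, X ω ∂μ :=
  (LinearMap.toContinuousLinearMap (dotProductBilin ℝ ℝ a)).integral_comp_comm hX

theorem ProbabilityTheory.IndepFun.integral_dotProduct [IsProbabilityMeasure μ]
    {X Y : Ω → Fin d → ℝ} (h : IndepFun X Y μ) (hX : MemLp X 2 μ) (hY : MemLp Y 2 μ) :
    ∫ ω, X ω ⬝ᵥ Y ω ∂μ = (∫ ω, X ω ∂μ) ⬝ᵥ ∫ ω, Y ω ∂μ := by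
  have hint : ∀ i, Integrable (fun ω => X ω i * Y ω i) μ := fun i =>
    (hX.eval i).integrable_mul (hY.eval i)
  simp only [dotProduct]
  rw [integral_finsetSum _ fun i _ => hint i]
  refine Finset.sum_congr rfl fun i _ => ?_
  rw [eval_integral fun i => (hX.eval i).integrable (by norm_num),
    eval_integral fun i => (hY.eval i).integrable (by norm_num)]
  exact (h.comp (measurable_pi_apply i) (measurable_pi_apply i)).integral_fun_mul_eq_mul_integral
    (hX.eval i).aestronglyMeasurable (hY.eval i).aestronglyMeasurable

theorem trace_mul_covMatrix [IsProbabilityMeasure μ] (M : Matrix (Fin d) (Fin d) ℝ)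
    {X : Ω → Fin d → ℝ} (hX : MemLp X 2 μ) :
    Matrix.trace (M * covMatrix μ X) = ∫ ω, quadForm M (X ω) ∂μ - quadForm M (∫ ω, X ω ∂μ) := by
  have hint : ∀ i j, Integrable (fun ω => X ω i * (M i j * X ω j)) μ := fun i j =>
    (hX.eval i).integrable_mul ((hX.eval j).const_mul _)
  simp only [quadForm, dotProduct, Matrix.mulVec, Finset.mul_sum]
  rw [integral_finsetSum _ fun i _ => integrable_finsetSum _ fun j _ => hint i j,
    ← Finset.sum_sub_distrib, Matrix.trace]
  refine Finset.sum_congr rfl fun i _ => ?_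
  rw [integral_finsetSum _ fun j _ => hint i j, ← Finset.sum_sub_distrib, Matrix.diag_apply,
    Matrix.mul_apply]
  refine Finset.sum_congr rfl fun j _ => ?_
  rw [eval_integral fun i => (hX.eval i).integrable (by norm_num),
    eval_integral fun i => (hX.eval i).integrable (by norm_num), covMatrix, Matrix.of_apply,
    covariance_eq_sub (hX.eval j) (hX.eval i), mul_sub, ← integral_const_mul]
  congr 1
  · exact integral_congr_ae (Eventually.of_forall fun ω => by simp only [Pi.mul_apply]; ring)
  · ring

/-- Jensen's inequality, obtained by integrating the tangent inequality at the mean. It makes the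
covariance penalties nonnegative. -/
theorem quadForm_integral_le [IsProbabilityMeasure μ] {M : Matrix (Fin d) (Fin d) ℝ}
    (hM : M.PosSemidef) {X : Ω → Fin d → ℝ} (hX : MemLp X 2 μ) :
    quadForm M (∫ ω, X ω ∂μ) ≤ ∫ ω, quadForm M (X ω) ∂μ := by
  set a := ∫ ω, X ω ∂μ with ha
  have h1 : ∀ ω, 2 * ((M *ᵥ a) ⬝ᵥ X ω) - quadForm M a ≤ quadForm M (X ω) := fun ω => by
    have := hM.quadForm_nonneg (X ω - a)
    rw [quadForm_sub hM.isSymm_real, dotProduct_comm] at this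
    linarith
  have hXi : Integrable X μ := hX.integrable (by norm_num)
  have hi := (hXi.const_dotProduct (M *ᵥ a)).const_mul 2
  have hi' : Integrable (fun ω => 2 * ((M *ᵥ a) ⬝ᵥ X ω) - quadForm M a) μ :=
    hi.sub (integrable_const _)
  have h2 := integral_mono hi' (hX.integrable_quadForm M) h1
  rw [integral_sub hi (integrable_const _), integral_const_mul,
    integral_const_dotProduct _ hXi, ← ha, integral_const] at h2
  simp only [probReal_univ, one_smul] at h2
  rw [dotProduct_comm] at h2
  have : quadForm M a = a ⬝ᵥ (M *ᵥ a) := rfl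
  linarith

end SquareIntegrable

/-! ### Independence of present and future noise. -/

section Independence

variable {Ω : Type*} [MeasurableSpace Ω] {μ : Measure Ω}

/-- The joint law is the product of three marginals, which may be reassociated. This groups a state
with the current noise, leaving the later noise independent of the pair. -/
theorem ProbabilityTheory.IndepFun.prodMk_left_of_prodMk_right [IsProbabilityMeasure μ]
    {α β γ : Type*} [MeasurableSpace α] [MeasurableSpace β] [MeasurableSpace γ]
    {X : Ω → α} {Y : Ω → β} {Z : Ω → γ} (hX : AEMeasurable X μ) (hY : AEMeasurable Y μ)
    (hZ : AEMeasurable Z μ) (h : IndepFun X (fun ω => (Y ω, Z ω)) μ) (hYZ : IndepFun Y Z μ) :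
    IndepFun (fun ω => (X ω, Y ω)) Z μ := by
  have := Measure.isProbabilityMeasure_map hX
  have := Measure.isProbabilityMeasure_map hY
  have := Measure.isProbabilityMeasure_map hZ
  have hXY : IndepFun X Y μ := h.comp measurable_id measurable_fst
  have h1 := (indepFun_iff_map_prod_eq_prod_map_map hX (hY.prodMk hZ)).1 h
  rw [(indepFun_iff_map_prod_eq_prod_map_map hY hZ).1 hYZ] at h1
  rw [indepFun_iff_map_prod_eq_prod_map_map (hX.prodMk hY) hZ,
    (indepFun_iff_map_prod_eq_prod_map_map hX hY).1 hXY]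
  have h3 := (measurePreserving_prodAssoc (μ.map X) (μ.map Y) (μ.map Z)).symm.map_eq
  rw [← h3, ← h1, AEMeasurable.map_map_of_aemeasurable
    (MeasurableEquiv.measurable _).aemeasurable (hX.prodMk (hY.prodMk hZ))]
  rfl

theorem ProbabilityTheory.iIndepFun.indepFun_tail {β : Type*} [MeasurableSpace β]
    {W : ℕ → Ω → β} (h : iIndepFun W μ) (hW : ∀ k, Measurable (W k)) (k : ℕ) :
    IndepFun (W k) (fun ω j => W (k + 1 + j) ω) μ := by
  have h1 := indep_iSup_of_disjoint (fun i => (hW i).comap_le) h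
    (S := {k}) (T := Set.Ioi k) (by simp)
  refine indep_of_indep_of_le_right (indep_of_indep_of_le_left h1 ?_) ?_
  · exact le_iSup₂ (f := fun i (_ : i ∈ ({k} : Set ℕ)) =>
      MeasurableSpace.comap (W i) inferInstance) k rfl
  · rw [← measurable_iff_comap_le]
    refine @measurable_pi_lambda _ _ _ (_) _ _ fun j => ?_
    rw [measurable_iff_comap_le]
    exact le_iSup₂ (f := fun i (_ : i ∈ Set.Ioi k) =>
      MeasurableSpace.comap (W i) inferInstance) (k + 1 + j) (by simp only [Set.mem_Ioi]; omega)

end Independence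

/-! ### Invariant laws of contracting linear iterations. -/

section InvariantLaw

variable {n m : ℕ}

/-- A linear iteration that is exponentially contracting, driven by square integrable i.i.d.
noise, has an invariant distribution with finite second moment. -/
theorem exists_invariant_law {M : Matrix (Fin n) (Fin n) ℝ} {κ γ : ℝ} (hγ : 0 ≤ γ)
    (hγ1 : γ < 1) (hM : ∀ j x, ‖(M ^ j) *ᵥ x‖ ≤ κ * γ ^ j * ‖x‖)
    (ν : Measure (Fin m → ℝ)) [IsProbabilityMeasure ν] {h : (Fin m → ℝ) → Fin n → ℝ}
    (hm : Measurable h) (hh : MemLp h 2 ν) :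
    ∃ ρ : Measure (Fin n → ℝ), IsP2 ρ ∧
      (ρ.prod ν).map (fun p => M *ᵥ p.1 + h p.2) = ρ := by
  set P : Measure (ℕ → Fin m → ℝ) := Measure.infinitePi fun _ => ν with hP
  -- On the infinite product of copies of `ν`, the invariant law is that of `Φ ω = ∑ M ^ j h (ω j)`.
  -- Here `ω 0` plays the newest noise, and `Φ ω = M Φ (sh ω) + h (ω 0)` with `sh` the
  -- measure-preserving shift, independent of `ω 0`.
  have hMm : ∀ N : Matrix (Fin n) (Fin n) ℝ, Measurable fun x : Fin n → ℝ => N *ᵥ x := fun N =>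
    (LinearMap.continuous_of_finiteDimensional N.mulVecLin).measurable
  set Y : ℕ → (ℕ → Fin m → ℝ) → Fin n → ℝ := fun j ω => (M ^ j) *ᵥ h (ω j) with hY
  have hYm : ∀ j, Measurable (Y j) := fun j => (hMm _).comp (hm.comp (measurable_pi_apply j))
  have hhP : ∀ j, MemLp (fun ω : ℕ → Fin m → ℝ => h (ω j)) 2 P := fun j =>
    hh.comp_measurePreserving (measurePreserving_eval_infinitePi (fun _ => ν) j)
  have hYL : ∀ j, MemLp (Y j) 2 P := fun j => (hhP j).mulVec _
  have hnorm : ∀ j, eLpNorm (Y j) 2 P ≤ ENNReal.ofReal (κ * γ ^ j) * eLpNorm h 2 ν := by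
    intro j
    rw [← eLpNorm_comp_measurePreserving hh.aestronglyMeasurable
      (measurePreserving_eval_infinitePi (fun _ => ν) j)]
    exact eLpNorm_le_mul_eLpNorm_of_ae_le_mul (Eventually.of_forall fun ω => hM j _) 2
  have hsum : ∑' j, eLpNorm (Y j) 2 P ≠ ⊤ := by
    refine ne_top_of_le_ne_top ?_ (ENNReal.tsum_le_tsum hnorm)
    rw [ENNReal.tsum_mul_right]
    refine ENNReal.mul_ne_top ?_ hh.eLpNorm_ne_top
    exact ((summable_geometric_of_lt_one hγ hγ1).mul_left κ).tsum_ofReal_ne_top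
  have hae : ∀ᵐ ω ∂P, Summable fun j => Y j ω := by
    filter_upwards [summable_norm_of_tsum_eLpNorm_ne_top (by norm_num)
      (fun j => (hYm j).aestronglyMeasurable) hsum] with ω hω using hω.of_norm
  set Φ : (ℕ → Fin m → ℝ) → Fin n → ℝ := fun ω => ∑' j, Y j ω with hΦ
  have hΦm : Measurable Φ := Measurable.tsum hYm
  -- The series also converges in `L²`, and its `L²` sum agrees almost everywhere with the pointwise
  -- one.
  have hΦL : MemLp Φ 2 P := by
    have hlp : ∑' j, ‖(hYL j).toLp (Y j)‖ₑ ≠ ⊤ := by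
      simpa only [Lp.enorm_toLp] using hsum
    have h1 := Lp.hasSum_coeFn_tsum hlp
    have h2 : ∀ᵐ ω ∂P, ∀ j, (hYL j).toLp (Y j) ω = Y j ω :=
      ae_all_iff.2 fun j => (hYL j).coeFn_toLp
    refine (memLp_congr_ae ?_).1 (Lp.memLp (∑' j, (hYL j).toLp (Y j)))
    filter_upwards [h1, h2] with ω h1 h2
    simp only [h2] at h1
    exact h1.tsum_eq.symm
  have hPP : IsProbabilityMeasure (P.map Φ) :=
    Measure.isProbabilityMeasure_map hΦm.aemeasurable
  refine ⟨P.map Φ, ⟨hPP, ?_⟩, ?_⟩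
  · rw [integrable_map_measure continuous_sqNorm.aestronglyMeasurable hΦm.aemeasurable]
    exact (memLp_two_iff_integrable_sqNorm hΦm.aestronglyMeasurable).1 hΦL
  · set sh : (ℕ → Fin m → ℝ) → ℕ → Fin m → ℝ := fun ω i => ω (i + 1) with hsh
    have hshm : Measurable sh := by fun_prop
    have hshP : P.map sh = P :=
      Measure.map_infinitePi_infinitePi_of_inj (P := fun _ : ℕ => ν) (add_left_injective 1)
    have hind : IndepFun sh (fun ω : ℕ → Fin m → ℝ => ω 0) P := by
      have h0 : iIndepFun (fun (i : ℕ) (ω : ℕ → Fin m → ℝ) => ω i) P :=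
        iIndepFun_infinitePi (P := fun _ : ℕ => ν) (X := fun _ x => x) fun _ => measurable_id
      have := (h0.indepFun_tail (fun i => measurable_pi_apply i) 0).symm
      simpa only [zero_add, hsh, add_comm] using this
    have hpair : (P.map Φ).prod ν = P.map fun ω => (Φ (sh ω), ω 0) := by
      have h1 : IndepFun (fun ω => Φ (sh ω)) (fun ω : ℕ → Fin m → ℝ => ω 0) P :=
        hind.comp hΦm measurable_id
      refine Eq.trans ?_ ((indepFun_iff_map_prod_eq_prod_map_map (hΦm.comp hshm).aemeasurable
        (measurable_pi_apply 0).aemeasurable).1 h1).symm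
      congr 1
      · exact (by rw [← Measure.map_map hΦm hshm, hshP] : P.map Φ = P.map (Φ ∘ sh))
      · exact (Measure.infinitePi_map_eval (fun _ : ℕ => ν) 0).symm
    have hFm : Measurable fun p : (Fin n → ℝ) × (Fin m → ℝ) => M *ᵥ p.1 + h p.2 :=
      ((hMm M).comp measurable_fst).add (hm.comp measurable_snd)
    have hpm : Measurable fun ω : ℕ → Fin m → ℝ => (Φ (sh ω), ω 0) :=
      (hΦm.comp hshm).prodMk (measurable_pi_apply 0)
    rw [hpair, Measure.map_map hFm hpm]
    refine Measure.map_congr ?_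
    have hae' : ∀ᵐ ω ∂P, Summable fun j => Y j (sh ω) := by
      have : ∀ᵐ ω ∂(P.map sh), Summable fun j => Y j ω := by rwa [hshP]
      exact ae_of_ae_map hshm.aemeasurable this
    filter_upwards [hae, hae'] with ω h1 h2
    simp only [Function.comp, hΦ]
    rw [h1.tsum_eq_zero_add]
    have h3 := (LinearMap.toContinuousLinearMap M.mulVecLin).map_tsum h2
    have h4 : M *ᵥ (∑' j, Y j (sh ω)) = ∑' j, Y (j + 1) ω := by
      refine h3.trans (tsum_congr fun j => ?_)
      simp only [LinearMap.coe_toContinuousLinearMap', Matrix.mulVecLin_apply, hY, hsh]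
      rw [Matrix.mulVec_mulVec, ← pow_succ']
    rw [h4, add_comm]
    simp [hY]

theorem exists_geometric_bound {M T : Matrix (Fin n) (Fin n) ℝ} (hT : T.PosDef) {c : ℝ}
    (hc : 0 < c) (h : ∀ x, quadForm T (M *ᵥ x) + c * sqNorm x ≤ quadForm T x) :
    ∃ κ γ : ℝ, 0 ≤ γ ∧ γ < 1 ∧ ∀ j x, ‖(M ^ j) *ᵥ x‖ ≤ κ * γ ^ j * ‖x‖ := by
  obtain ⟨r, hr, hrT⟩ := hT.exists_le_quadForm
  obtain ⟨C, hC, hTC⟩ := exists_quadForm_le T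
  -- Bounding `‖x‖²` below by the form at `M x`, up to the factor `C`, gives this rate, which lies
  -- in `[0, 1)` without comparing `c` and `C`.
  set θ : ℝ := C / (C + c) with hθ
  have hθ0 : 0 ≤ θ := by positivity
  have hθ1 : θ < 1 := by rw [hθ, div_lt_one (by positivity)]; linarith
  have hstep : ∀ x, quadForm T (M *ᵥ x) ≤ θ * quadForm T x := by
    intro x
    have h1 := h x
    have h2 := hTC x
    have h3 := hT.posSemidef.quadForm_nonneg (M *ᵥ x)
    have h4 := sqNorm_nonneg x
    rw [hθ, div_mul_eq_mul_div, le_div_iff₀ (by positivity)]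
    have h5 := mul_le_mul_of_nonneg_left h1 hC.le
    have h6 := mul_le_mul_of_nonneg_left h2 hc.le
    have h7 : c * quadForm T (M *ᵥ x) ≤ c * quadForm T x :=
      mul_le_mul_of_nonneg_left (by nlinarith) hc.le
    linarith
  have hpow : ∀ j x, quadForm T (M ^ j *ᵥ x) ≤ θ ^ j * quadForm T x := by
    intro j
    induction j with
    | zero => intro x; simp
    | succ j ih =>
      intro x
      rw [pow_succ, ← Matrix.mulVec_mulVec, pow_succ, mul_assoc]
      exact (ih _).trans (mul_le_mul_of_nonneg_left (hstep x) (by positivity))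
  have hsup : ∀ x : Fin n → ℝ, ‖x‖ ^ 2 ≤ sqNorm x := by
    intro x
    rw [← Real.le_sqrt (norm_nonneg _) (sqNorm_nonneg _)]
    refine (pi_norm_le_iff_of_nonneg (Real.sqrt_nonneg _)).2 fun i => ?_
    rw [Real.norm_eq_abs, ← Real.sqrt_sq_eq_abs]
    refine Real.sqrt_le_sqrt ?_
    rw [sqNorm_eq_sum]
    exact Finset.single_le_sum (f := fun i => x i ^ 2) (fun _ _ => sq_nonneg _)
      (Finset.mem_univ i)
  have hsup' : ∀ x : Fin n → ℝ, sqNorm x ≤ n * ‖x‖ ^ 2 := by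
    intro x
    rw [sqNorm_eq_sum]
    refine (Finset.sum_le_card_nsmul _ _ (‖x‖ ^ 2) fun i _ => ?_).trans (by simp)
    rw [← sq_abs]
    exact pow_le_pow_left₀ (abs_nonneg _) (norm_le_pi_norm x i) 2
  -- The ratio `C / r` compares the form with the Euclidean norm; the factor `n` passes to the sup
  -- norm.
  refine ⟨√(C * n / r), √θ, Real.sqrt_nonneg _, ?_, fun j x => ?_⟩
  · rw [Real.sqrt_lt' one_pos]; simpa using hθ1
  · refine abs_le_of_sq_le_sq' ?_ (by positivity) |>.2
    have e : (√(C * n / r) * √θ ^ j * ‖x‖) ^ 2 = r⁻¹ * (θ ^ j * (C * (n * ‖x‖ ^ 2))) := by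
      rw [mul_pow, mul_pow, Real.sq_sqrt (by positivity), ← pow_mul, mul_comm j 2, pow_mul,
        Real.sq_sqrt hθ0]
      ring
    rw [e, ← div_eq_inv_mul, le_div_iff₀ hr]
    have h1 := hsup (M ^ j *ᵥ x)
    have h2 := hrT (M ^ j *ᵥ x)
    have h3 := hpow j x
    have h4 : θ ^ j * quadForm T x ≤ θ ^ j * (C * (n * ‖x‖ ^ 2)) := by
      refine mul_le_mul_of_nonneg_left ((hTC x).trans ?_) (by positivity)
      exact mul_le_mul_of_nonneg_left (hsup' x) hC.le
    nlinarith

end InvariantLaw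

/-! ### Translation invariance of the covariance. -/

section Covariance

variable {Ω : Type*} [MeasurableSpace Ω] {μ : Measure Ω} [IsProbabilityMeasure μ] {d : ℕ}

theorem covMatrix_add_const {X : Ω → Fin d → ℝ} (hX : MemLp X 2 μ) (a : Fin d → ℝ) :
    covMatrix μ (fun ω => X ω + a) = covMatrix μ X := by
  ext i j
  simp only [covMatrix, Matrix.of_apply, Pi.add_apply]
  rw [covariance_add_const_left ((hX.eval i).integrable (by norm_num)),
    covariance_add_const_right ((hX.eval j).integrable (by norm_num))]

end Covariance

/-! ### The dissipation equality. -/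

namespace LQData

variable {n l m : ℕ} (D : LQData n l m)

theorem f_add {xe : Fin n → ℝ} {ue : Fin l → ℝ} {w₀ : Fin m → ℝ}
    (hfix : D.f xe ue w₀ = xe) (x : Fin n → ℝ) (u : Fin l → ℝ) (w : Fin m → ℝ) :
    D.f (x + xe) (u + ue) w = (D.A *ᵥ x + D.B *ᵥ u + D.E *ᵥ (w - w₀)) + xe := by
  conv_rhs => rw [← hfix]
  simp only [f, Matrix.mulVec_add, Matrix.mulVec_sub]
  abel

theorem closedLoop_succ_eq_comp {Ω : Type*} (W : ℕ → Ω → Fin m → ℝ) (π : (Fin n → ℝ) → Fin l → ℝ)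
    (X₀ : Ω → Fin n → ℝ) (k : ℕ) :
    D.closedLoop W π X₀ (k + 1) = (fun p : (Fin n → ℝ) × (Fin m → ℝ) => D.f p.1 (π p.1) p.2) ∘
      fun ω => (D.closedLoop W π X₀ k ω, W k ω) := rfl

theorem continuous_feedback (P : Matrix (Fin n) (Fin n) ℝ) (xbar : Fin n → ℝ) (ubar : Fin l → ℝ) :
    Continuous (D.feedback P xbar ubar) := by
  unfold feedback; fun_prop

variable {Ω : Type*} [MeasurableSpace Ω] {μ : Measure Ω}

theorem memLp_f [IsFiniteMeasure μ] {X : Ω → Fin n → ℝ} {U : Ω → Fin l → ℝ} {V : Ω → Fin m → ℝ}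
    (hX : MemLp X 2 μ) (hU : MemLp U 2 μ) (hV : MemLp V 2 μ) :
    MemLp (fun ω => D.f (X ω) (U ω) (V ω)) 2 μ :=
  (((hX.mulVec D.A).add (hU.mulVec D.B)).add (hV.mulVec D.E)).add (memLp_const _)

theorem memLp_feedback [IsFiniteMeasure μ] (P : Matrix (Fin n) (Fin n) ℝ) (xbar : Fin n → ℝ)
    (ubar : Fin l → ℝ) {X : Ω → Fin n → ℝ} (hX : MemLp X 2 μ) :
    MemLp (fun ω => D.feedback P xbar ubar (X ω)) 2 μ :=
  ((hX.sub (memLp_const _)).mulVec _).add (memLp_const _)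

section Dissipation

/-- The stage cost in coordinates centered at a steady state that satisfies the first order
optimality conditions with multiplier `p`. -/
theorem stageCost_add_const [IsProbabilityMeasure μ] (hQ₁ : D.Q₁.PosSemidef) (hR₁ : D.R₁.PosDef)
    {xe p : Fin n → ℝ} {ue : Fin l → ℝ}
    (hopt : ∀ x u, 2 * (x ⬝ᵥ (D.Q₁ *ᵥ xe)) + 2 * (u ⬝ᵥ (D.R₁ *ᵥ ue)) + D.s ⬝ᵥ x + D.v ⬝ᵥ u
      + p ⬝ᵥ (x - (D.A *ᵥ x + D.B *ᵥ u)) = 0)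
    {X : Ω → Fin n → ℝ} {U : Ω → Fin l → ℝ} (hX : MemLp X 2 μ) (hU : MemLp U 2 μ) :
    D.stageCost μ (fun ω => X ω + xe) (fun ω => U ω + ue)
      = ∫ ω, (quadForm (D.Q₁ + D.Q₂) (X ω) + quadForm (D.R₁ + D.R₂) (U ω)
          - p ⬝ᵥ (X ω - (D.A *ᵥ X ω + D.B *ᵥ U ω))) ∂μ
        + (quadForm D.Q₁ xe + quadForm D.R₁ ue + D.s ⬝ᵥ xe + D.v ⬝ᵥ ue + D.c)
        - quadForm D.Q₂ (∫ ω, X ω ∂μ) - quadForm D.R₂ (∫ ω, U ω ∂μ) := by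
  have hlin : Integrable (fun ω => p ⬝ᵥ (X ω - (D.A *ᵥ X ω + D.B *ᵥ U ω))) μ :=
    ((hX.sub ((hX.mulVec D.A).add (hU.mulVec D.B))).integrable (by norm_num)).const_dotProduct p
  rw [stageCost, covMatrix_add_const hX, covMatrix_add_const hU, trace_mul_covMatrix _ hX,
    trace_mul_covMatrix _ hU]
  have h1 : ∀ ω, quadForm D.Q₁ (X ω + xe) + quadForm D.R₁ (U ω + ue) + D.s ⬝ᵥ (X ω + xe)
      + D.v ⬝ᵥ (U ω + ue) + D.c
      = (quadForm D.Q₁ (X ω) + quadForm D.R₁ (U ω)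
          - p ⬝ᵥ (X ω - (D.A *ᵥ X ω + D.B *ᵥ U ω)))
        + (quadForm D.Q₁ xe + quadForm D.R₁ ue + D.s ⬝ᵥ xe + D.v ⬝ᵥ ue + D.c) := by
    intro ω
    rw [quadForm_add hQ₁.isSymm_real, quadForm_add hR₁.posSemidef.isSymm_real, dotProduct_add,
      dotProduct_add]
    linear_combination hopt (X ω) (U ω)
  simp only [h1, quadForm_add_matrix]
  have i1 := hX.integrable_quadForm D.Q₁
  have i2 := hX.integrable_quadForm D.Q₂
  have i3 := hU.integrable_quadForm D.R₁
  have i4 := hU.integrable_quadForm D.R₂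
  rw [integral_add ((i1.fun_add i3).fun_sub hlin) (integrable_const _),
    integral_sub (i1.fun_add i3) hlin, integral_add i1 i3,
    integral_sub ((i1.fun_add i2).fun_add (i3.fun_add i4)) hlin,
    integral_add (i1.fun_add i2) (i3.fun_add i4), integral_add i1 i2, integral_add i3 i4,
    integral_const]
  simp only [probReal_univ, one_smul]
  ring

/-- The pointwise identity behind the dissipation equality. -/
theorem dissipation_pointwise (hR₁ : D.R₁.PosDef) (hR₂ : D.R₂.PosSemidef)
    {P S : Matrix (Fin n) (Fin n) ℝ} (hP : P.PosSemidef) (hRic : D.IsRiccatiSolution P)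
    (hS : S.PosDef) {p q xt : Fin n → ℝ} (hq : q = p - (2 : ℝ) • (S *ᵥ xt))
    (x y e : Fin n → ℝ) (u : Fin l → ℝ) {a b : Fin n → ℝ} (ha : a = D.A *ᵥ x + D.B *ᵥ u)
    (hb : b = D.A *ᵥ y + D.B *ᵥ (D.gain P *ᵥ y)) :
    (quadForm (D.Q₁ + D.Q₂) x + quadForm (D.R₁ + D.R₂) u - p ⬝ᵥ (x - a))
      - (quadForm (D.Q₁ + D.Q₂) y + quadForm (D.R₁ + D.R₂) (D.gain P *ᵥ y) - p ⬝ᵥ (y - b))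
      + (quadForm (P + S) (x - y + xt) - quadForm P (x + xt) + q ⬝ᵥ (x - y + xt))
      - (quadForm (P + S) (a - b + xt) - quadForm P (a + e + xt) + q ⬝ᵥ (a - b + xt))
    = (quadForm (D.Q₁ + D.Q₂) (x - y) + quadForm (D.R₁ + D.R₂) (u - D.gain P *ᵥ y)
        + quadForm S (x - y) - quadForm S (a - b))
      + (quadForm P (b + e) - quadForm P y + 2 * ((a - b) ⬝ᵥ (P *ᵥ e))
        + 2 * ((P *ᵥ xt) ⬝ᵥ (b + e - y))) := by
  have hR : (D.R₁ + D.R₂).PosDef := hR₁.add_posSemidef hR₂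
  have hric : riccatiMap D.A D.B (D.Q₁ + D.Q₂) (D.R₁ + D.R₂) P = P := hRic.symm
  have hK : riccatiGain D.A D.B (D.R₁ + D.R₂) P = D.gain P := rfl
  -- The squares completed for `(x, u)` and for the difference coincide because `u - K y - K (x - y)
  -- = u - K x`; that for `(y, K y)` is zero. Hence `h1 - h2 - h3` contains no square.
  have h1 := bellman_eq (A := D.A) (B := D.B) (Q := D.Q₁ + D.Q₂) hP hR x u
  have h2 := bellman_eq (A := D.A) (B := D.B) (Q := D.Q₁ + D.Q₂) hP hR y (D.gain P *ᵥ y)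
  have h3 := bellman_eq (A := D.A) (B := D.B) (Q := D.Q₁ + D.Q₂) hP hR (x - y)
    (u - D.gain P *ᵥ y)
  have e1 : D.A *ᵥ (x - y) + D.B *ᵥ (u - D.gain P *ᵥ y) = a - b := by
    rw [ha, hb, Matrix.mulVec_sub, Matrix.mulVec_sub]; abel
  have e2 : u - D.gain P *ᵥ y - D.gain P *ᵥ (x - y) = u - D.gain P *ᵥ x := by
    rw [Matrix.mulVec_sub]; abel
  rw [hric, hK] at h1 h2 h3
  rw [e1, e2] at h3
  rw [← ha] at h1
  rw [← hb, sub_self, quadForm_zero] at h2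
  have hPs := hP.isSymm_real
  have hSs := hS.posSemidef.isSymm_real
  have hc : ∀ (M : Matrix (Fin n) (Fin n) ℝ) (z : Fin n → ℝ),
      (M *ᵥ xt) ⬝ᵥ z = z ⬝ᵥ (M *ᵥ xt) := fun M z => dotProduct_comm _ _
  -- The shift by `xt` creates `2 (S xt) ⬝ᵥ (x - y)`, which `q` removes, leaving `p ⬝ᵥ (x - y)` to
  -- offset the multiplier terms. The corresponding `P` cross terms in `x` cancel, up to a
  -- contribution in `y` and `e` alone.
  subst hq
  simp only [quadForm_add_matrix P S, quadForm_add hPs, quadForm_add hSs, quadForm_sub hPs,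
    quadForm_sub hSs, sub_dotProduct, add_dotProduct, dotProduct_add, dotProduct_sub,
    smul_dotProduct, smul_eq_mul, hc] at h1 h2 h3 ⊢
  linear_combination h1 - h2 - h3

theorem integrable_storage [IsFiniteMeasure μ] (P S : Matrix (Fin n) (Fin n) ℝ)
    (q xs xt : Fin n → ℝ) {X Y : Ω → Fin n → ℝ} (hX : MemLp X 2 μ) (hY : MemLp Y 2 μ) :
    Integrable (fun ω => quadForm (P + S) (X ω - (Y ω - xt)) - quadForm P (X ω - xs)
      + q ⬝ᵥ (X ω - (Y ω - xt))) μ := by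
  have h1 : MemLp (fun ω => X ω - (Y ω - xt)) 2 μ := hX.sub (hY.sub (memLp_const _))
  have h2 : MemLp (fun ω => X ω - xs) 2 μ := hX.sub (memLp_const _)
  exact ((h1.integrable_quadForm _).sub (h2.integrable_quadForm _)).add
    ((h1.integrable (by norm_num)).const_dotProduct q)

/-- The dissipation equality. -/
theorem dissipation_eq [IsProbabilityMeasure μ] (hQ₁ : D.Q₁.PosSemidef)
    (hR₁ : D.R₁.PosDef) (hR₂ : D.R₂.PosSemidef)
    {P S : Matrix (Fin n) (Fin n) ℝ} (hP : P.PosSemidef) (hRic : D.IsRiccatiSolution P)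
    (hS : S.PosDef) {p q xs xt xe : Fin n → ℝ} {ue : Fin l → ℝ} (hxe : xe = xt + xs)
    (hq : q = p - (2 : ℝ) • (S *ᵥ xt))
    (hopt : ∀ x u, 2 * (x ⬝ᵥ (D.Q₁ *ᵥ xe)) + 2 * (u ⬝ᵥ (D.R₁ *ᵥ ue)) + D.s ⬝ᵥ x + D.v ⬝ᵥ u
      + p ⬝ᵥ (x - (D.A *ᵥ x + D.B *ᵥ u)) = 0)
    {V : Ω → Fin m → ℝ} (hV : MemLp V 2 μ) (hfix : D.f xe ue (∫ ω, V ω ∂μ) = xe)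
    {Xs : ℕ → Ω → Fin n → ℝ} {k : ℕ} (hXs : MemLp (Xs k) 2 μ) (hXsm : ∫ ω, Xs k ω ∂μ = xe)
    (hXsV : IndepFun V (Xs k) μ)
    (hXs' : ∀ ω, Xs (k + 1) ω = D.f (Xs k ω) (D.feedback P xe ue (Xs k ω)) (V ω))
    (hstat : ∫ ω, quadForm P (Xs (k + 1) ω - xe) ∂μ = ∫ ω, quadForm P (Xs k ω - xe) ∂μ)
    {X : Ω → Fin n → ℝ} {U : Ω → Fin l → ℝ} (hX : MemLp X 2 μ) (hU : MemLp U 2 μ)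
    (hXV : IndepFun V X μ) (hUV : IndepFun V U μ) :
    D.stageCost μ X U - D.stageCost μ (Xs k) (fun ω => D.feedback P xe ue (Xs k ω))
      + storage μ P S q xs xt Xs k X
      - storage μ P S q xs xt Xs (k + 1) (fun ω => D.f (X ω) (U ω) (V ω))
    = ∫ ω, (quadForm (D.Q₁ + D.Q₂) (X ω - Xs k ω)
        + quadForm (D.R₁ + D.R₂) (U ω - D.feedback P xe ue (Xs k ω))
        + quadForm S (X ω - Xs k ω)
        - quadForm S (D.A *ᵥ (X ω - Xs k ω) + D.B *ᵥ (U ω - D.feedback P xe ue (Xs k ω)))) ∂μ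
      - quadForm D.Q₂ (∫ ω, (X ω - Xs k ω) ∂μ)
      - quadForm D.R₂ (∫ ω, (U ω - D.feedback P xe ue (Xs k ω)) ∂μ) := by
  set w₀ := ∫ ω, V ω ∂μ with hw₀
  obtain ⟨x, hx⟩ : ∃ x : Ω → Fin n → ℝ, x = fun ω => X ω - xe := ⟨_, rfl⟩
  obtain ⟨u, hu⟩ : ∃ u : Ω → Fin l → ℝ, u = fun ω => U ω - ue := ⟨_, rfl⟩
  obtain ⟨y, hy⟩ : ∃ y : Ω → Fin n → ℝ, y = fun ω => Xs k ω - xe := ⟨_, rfl⟩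
  obtain ⟨e, he⟩ : ∃ e : Ω → Fin n → ℝ, e = fun ω => D.E *ᵥ (V ω - w₀) := ⟨_, rfl⟩
  have hxL : MemLp x 2 μ := hx ▸ hX.sub (memLp_const _)
  have huL : MemLp u 2 μ := hu ▸ hU.sub (memLp_const _)
  have hyL : MemLp y 2 μ := hy ▸ hXs.sub (memLp_const _)
  have hVL : MemLp (fun ω => V ω - w₀) 2 μ := hV.sub (memLp_const _)
  have heL : MemLp e 2 μ := he ▸ hVL.mulVec D.E
  have hKyL : MemLp (fun ω => D.gain P *ᵥ y ω) 2 μ := hyL.mulVec _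
  have hXsI : Integrable (Xs k) μ := hXs.integrable (by norm_num)
  have hVI : Integrable V μ := hV.integrable (by norm_num)
  have hy0 : ∫ ω, y ω ∂μ = 0 := by
    rw [hy, integral_sub hXsI (integrable_const _), hXsm]; simp
  have he0 : ∫ ω, e ω ∂μ = 0 := by
    rw [he, integral_mulVec _ (hVL.integrable (by norm_num)),
      integral_sub hVI (integrable_const _), ← hw₀]; simp
  have hKy0 : ∫ ω, D.gain P *ᵥ y ω ∂μ = 0 := by
    rw [integral_mulVec _ (hyL.integrable (by norm_num)), hy0, Matrix.mulVec_zero]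
  obtain ⟨a, ha⟩ : ∃ a : Ω → Fin n → ℝ, a = fun ω => D.A *ᵥ x ω + D.B *ᵥ u ω := ⟨_, rfl⟩
  obtain ⟨b, hb⟩ : ∃ b : Ω → Fin n → ℝ, b = fun ω => D.A *ᵥ y ω + D.B *ᵥ (D.gain P *ᵥ y ω) :=
    ⟨_, rfl⟩
  have haL : MemLp a 2 μ := ha ▸ (hxL.mulVec _).add (huL.mulVec _)
  have hbL : MemLp b 2 μ := hb ▸ (hyL.mulVec _).add (hKyL.mulVec _)
  have eX : X = fun ω => x ω + xe := by funext ω; simp [hx]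
  have eU : U = fun ω => u ω + ue := by funext ω; simp [hu]
  have eXs : Xs k = fun ω => y ω + xe := by funext ω; simp [hy]
  have eπ : ∀ ω, D.feedback P xe ue (Xs k ω) = D.gain P *ᵥ y ω + ue := by
    intro ω; simp [hy, feedback]
  have eX' : ∀ ω, D.f (X ω) (U ω) (V ω) = a ω + e ω + xe := by
    intro ω; rw [eX, eU, D.f_add hfix, ha, he]
  have eXs' : ∀ ω, Xs (k + 1) ω = b ω + e ω + xe := by
    intro ω; rw [hXs', eπ, eXs, D.f_add hfix, hb, he]
  -- independence of the noise from states and controls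
  have hee : ∀ (d : ℕ) (Z : Ω → Fin d → ℝ) (M : Matrix (Fin n) (Fin d) ℝ) (c : Fin d → ℝ),
      MemLp Z 2 μ → IndepFun V Z μ → ∫ ω, e ω ⬝ᵥ (M *ᵥ (Z ω - c)) ∂μ = 0 := by
    intro d Z M c hZ hVZ
    have hind : IndepFun e (fun ω => M *ᵥ (Z ω - c)) μ := by
      rw [he]
      refine hVZ.comp (φ := fun v => D.E *ᵥ (v - w₀)) (ψ := fun z => M *ᵥ (z - c)) ?_ ?_
      · exact Continuous.measurable (by fun_prop)
      · exact Continuous.measurable (by fun_prop)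
    rw [hind.integral_dotProduct heL ((hZ.sub (memLp_const _)).mulVec M), he0, zero_dotProduct]
  have hcross : ∫ ω, (a ω - b ω) ⬝ᵥ (P *ᵥ e ω) ∂μ = 0 := by
    have hpt : ∀ ω, (a ω - b ω) ⬝ᵥ (P *ᵥ e ω)
        = e ω ⬝ᵥ ((P * D.A) *ᵥ (X ω - xe)) + e ω ⬝ᵥ ((P * D.B) *ᵥ (U ω - ue))
          - e ω ⬝ᵥ ((P * (D.A + D.B * D.gain P)) *ᵥ (Xs k ω - xe)) := by
      intro ω
      rw [dotProduct_mulVec_swap hP.isSymm_real, ha, hb, hx, hu, hy]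
      simp only [← Matrix.mulVec_mulVec, Matrix.add_mulVec, Matrix.mulVec_sub, Matrix.mulVec_add,
        dotProduct_sub, dotProduct_add]
      ring
    have j1 := heL.integrable_dotProduct ((hX.sub (memLp_const xe)).mulVec (P * D.A))
    have j2 := heL.integrable_dotProduct ((hU.sub (memLp_const ue)).mulVec (P * D.B))
    have j3 := heL.integrable_dotProduct
      ((hXs.sub (memLp_const xe)).mulVec (P * (D.A + D.B * D.gain P)))
    simp only [Pi.sub_apply] at j1 j2 j3
    simp only [hpt]
    rw [integral_sub (j1.fun_add j2) j3, integral_add j1 j2, hee _ _ _ _ hX hXV, hee _ _ _ _ hU hUV,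
      hee _ _ _ _ hXs hXsV]
    simp
  have hbe : MemLp (fun ω => b ω + e ω) 2 μ := hbL.add heL
  have hbe0 : ∫ ω, (b ω + e ω - y ω) ∂μ = 0 := by
    have hb0 : ∫ ω, b ω ∂μ = 0 := by
      rw [hb, integral_add ((hyL.mulVec D.A).integrable (by norm_num))
        ((hKyL.mulVec D.B).integrable (by norm_num)),
        integral_mulVec _ (hyL.integrable (by norm_num)),
        integral_mulVec _ (hKyL.integrable (by norm_num)), hy0, hKy0]
      simp
    rw [integral_sub (hbe.integrable (by norm_num)) (hyL.integrable (by norm_num)),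
      integral_add (hbL.integrable (by norm_num)) (heL.integrable (by norm_num)), hb0, he0, hy0]
    simp
  have hstat' : ∫ ω, quadForm P (b ω + e ω) ∂μ = ∫ ω, quadForm P (y ω) ∂μ := by
    have h1 : ∀ ω, b ω + e ω = Xs (k + 1) ω - xe := fun ω => by rw [eXs']; abel
    simp only [h1, hstat, hy]
  -- These are the terms outside the cost of the difference: the first two balance by stationarity,
  -- the cross term by independence from centred noise, the last because all means are zero.
  have hG : ∫ ω, (quadForm P (b ω + e ω) - quadForm P (y ω) + 2 * ((a ω - b ω) ⬝ᵥ (P *ᵥ e ω))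
      + 2 * ((P *ᵥ xt) ⬝ᵥ (b ω + e ω - y ω))) ∂μ = 0 := by
    have i1 := hbe.integrable_quadForm P
    have i2 := hyL.integrable_quadForm P
    have i3 := ((haL.sub hbL).integrable_dotProduct (heL.mulVec P)).const_mul 2
    have hbey : MemLp (fun ω => b ω + e ω - y ω) 2 μ := hbe.sub hyL
    have i4 := ((hbey.integrable (by norm_num)).const_dotProduct (P *ᵥ xt)).const_mul 2
    simp only [Pi.sub_apply] at i3
    rw [integral_add ((i1.fun_sub i2).fun_add i3) i4, integral_add (i1.fun_sub i2) i3,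
      integral_sub i1 i2, integral_const_mul, integral_const_mul, hcross, hstat',
      integral_const_dotProduct _ (hbey.integrable (by norm_num)), hbe0]
    simp
  have c1 := D.stageCost_add_const (μ := μ) hQ₁ hR₁ hopt hxL huL
  rw [← eX, ← eU] at c1
  have c2 := D.stageCost_add_const (μ := μ) hQ₁ hR₁ hopt hyL hKyL
  rw [← eXs, ← funext eπ] at c2
  rw [hy0, hKy0, quadForm_zero, quadForm_zero] at c2
  have s1 : storage μ P S q xs xt Xs k X = ∫ ω, (quadForm (P + S) (x ω - y ω + xt)
      - quadForm P (x ω + xt) + q ⬝ᵥ (x ω - y ω + xt)) ∂μ := by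
    refine integral_congr_ae (Eventually.of_forall fun ω => ?_)
    have h1 : X ω - (Xs k ω - xt) = x ω - y ω + xt := by simp only [eX, eXs]; abel
    have h2 : X ω - xs = x ω + xt := by simp only [eX, hxe]; abel
    simp only [h1, h2]
  have s2 : storage μ P S q xs xt Xs (k + 1) (fun ω => D.f (X ω) (U ω) (V ω))
      = ∫ ω, (quadForm (P + S) (a ω - b ω + xt)
        - quadForm P (a ω + e ω + xt) + q ⬝ᵥ (a ω - b ω + xt)) ∂μ := by
    refine integral_congr_ae (Eventually.of_forall fun ω => ?_)
    have h1 : D.f (X ω) (U ω) (V ω) - (Xs (k + 1) ω - xt) = a ω - b ω + xt := by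
      rw [eX', eXs']; abel
    have h2 : D.f (X ω) (U ω) (V ω) - xs = a ω + e ω + xt := by rw [eX', hxe]; abel
    simp only [h1, h2]
  have hd : ∀ ω, X ω - Xs k ω = x ω - y ω := fun ω => by simp only [eX, eXs]; abel
  have hη : ∀ ω, U ω - D.feedback P xe ue (Xs k ω) = u ω - D.gain P *ᵥ y ω := fun ω => by
    rw [eπ]; simp only [eU]; abel
  have hab : ∀ ω, D.A *ᵥ (x ω - y ω) + D.B *ᵥ (u ω - D.gain P *ᵥ y ω) = a ω - b ω := by
    intro ω; rw [ha, hb]; simp only [Matrix.mulVec_sub]; abel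
  have ea : ∀ ω, D.A *ᵥ x ω + D.B *ᵥ u ω = a ω := fun ω => by rw [ha]
  have eb : ∀ ω, D.A *ᵥ y ω + D.B *ᵥ (D.gain P *ᵥ y ω) = b ω := fun ω => by rw [hb]
  simp only [ea] at c1
  simp only [eb] at c2
  -- The centred reference has mean zero, so the mean terms subtracted in the covariances of `x` and
  -- `u` are already those of the differences.
  have m1 : ∫ ω, (x ω - y ω) ∂μ = ∫ ω, x ω ∂μ := by
    rw [integral_sub (hxL.integrable (by norm_num)) (hyL.integrable (by norm_num)), hy0, sub_zero]
  have m2 : ∫ ω, (u ω - D.gain P *ᵥ y ω) ∂μ = ∫ ω, u ω ∂μ := by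
    rw [integral_sub (huL.integrable (by norm_num)) (hKyL.integrable (by norm_num)), hKy0, sub_zero]
  simp only [hd, hη, hab]
  rw [c1, c2, s1, s2, m1, m2]
  have g1 : Integrable (fun ω => quadForm (D.Q₁ + D.Q₂) (x ω) + quadForm (D.R₁ + D.R₂) (u ω)
      - p ⬝ᵥ (x ω - a ω)) μ :=
    ((hxL.integrable_quadForm _).add (huL.integrable_quadForm _)).sub
      (((hxL.sub haL).integrable (by norm_num)).const_dotProduct p)
  have g2 : Integrable (fun ω => quadForm (D.Q₁ + D.Q₂) (y ω)
      + quadForm (D.R₁ + D.R₂) (D.gain P *ᵥ y ω) - p ⬝ᵥ (y ω - b ω)) μ :=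
    ((hyL.integrable_quadForm _).add (hKyL.integrable_quadForm _)).sub
      (((hyL.sub hbL).integrable (by norm_num)).const_dotProduct p)
  have l3 : MemLp (fun ω => x ω - y ω + xt) 2 μ := (hxL.sub hyL).add (memLp_const _)
  have l4 : MemLp (fun ω => a ω - b ω + xt) 2 μ := (haL.sub hbL).add (memLp_const _)
  have l5 : MemLp (fun ω => x ω + xt) 2 μ := hxL.add (memLp_const _)
  have l6 : MemLp (fun ω => a ω + e ω + xt) 2 μ := (haL.add heL).add (memLp_const _)
  have g3 : Integrable (fun ω => quadForm (P + S) (x ω - y ω + xt)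
      - quadForm P (x ω + xt) + q ⬝ᵥ (x ω - y ω + xt)) μ :=
    ((l3.integrable_quadForm _).sub (l5.integrable_quadForm _)).add
      ((l3.integrable (by norm_num)).const_dotProduct q)
  have g4 : Integrable (fun ω => quadForm (P + S) (a ω - b ω + xt)
      - quadForm P (a ω + e ω + xt) + q ⬝ᵥ (a ω - b ω + xt)) μ :=
    ((l4.integrable_quadForm _).sub (l6.integrable_quadForm _)).add
      ((l4.integrable (by norm_num)).const_dotProduct q)
  have hsum := integral_sub ((g1.fun_sub g2).fun_add g3) g4
  rw [integral_add (g1.fun_sub g2) g3, integral_sub g1 g2] at hsum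
  have hpoint := fun ω => D.dissipation_pointwise hR₁ hR₂ hP hRic hS hq (x ω) (y ω)
    (e ω) (u ω) (ea ω).symm (eb ω).symm
  have g5 : Integrable (fun ω => quadForm (D.Q₁ + D.Q₂) (x ω - y ω)
      + quadForm (D.R₁ + D.R₂) (u ω - D.gain P *ᵥ y ω)
      + quadForm S (x ω - y ω) - quadForm S (a ω - b ω)) μ :=
    ((((hxL.sub hyL).integrable_quadForm _).add ((huL.sub hKyL).integrable_quadForm _)).add
      ((hxL.sub hyL).integrable_quadForm _)).sub ((haL.sub hbL).integrable_quadForm _)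
  have g6 : Integrable (fun ω => quadForm P (b ω + e ω) - quadForm P (y ω)
      + 2 * ((a ω - b ω) ⬝ᵥ (P *ᵥ e ω)) + 2 * ((P *ᵥ xt) ⬝ᵥ (b ω + e ω - y ω))) μ :=
    (((hbe.integrable_quadForm P).sub (hyL.integrable_quadForm P)).add
      (((haL.sub hbL).integrable_dotProduct (heL.mulVec P)).const_mul 2)).add
      ((((hbe.sub hyL).integrable (by norm_num)).const_dotProduct (P *ᵥ xt)).const_mul 2)
  rw [integral_congr_ae (Eventually.of_forall hpoint), integral_add g5 g6, hG] at hsum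
  linarith

end Dissipation

end LQData

/-! ### Bounds on storage and supply, stationarity, and the turnpike property. -/

namespace LQData

variable {n l m : ℕ} (D : LQData n l m)
variable {Ω : Type*} [MeasurableSpace Ω] {μ : Measure Ω}

/-- The storage function is bounded from below if the reference process is stationary. -/
theorem storage_bddBelow [IsProbabilityMeasure μ] {P S : Matrix (Fin n) (Fin n) ℝ}
    (hP : P.PosSemidef) (hS : S.PosDef) (q xs xt : Fin n → ℝ) {Xs : ℕ → Ω → Fin n → ℝ}
    (hXs : ∀ k, MemLp (Xs k) 2 μ)
    (hstat : ∀ k (M : Matrix (Fin n) (Fin n) ℝ),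
      ∫ ω, quadForm M (Xs k ω - (xt + xs)) ∂μ = ∫ ω, quadForm M (Xs 0 ω - (xt + xs)) ∂μ) :
    ∃ C : ℝ, ∀ k, ∀ X : Ω → Fin n → ℝ, MemLp X 2 μ → C ≤ storage μ P S q xs xt Xs k X := by
  obtain ⟨r, hr, hrS⟩ := hS.exists_le_quadForm
  -- With `g = X - (Xs k - xt)` and `y` the centred reference, the `P`-form of `g` cancels and `S`
  -- remains to absorb two linear terms. Half of `r‖g‖²` pays for `2 g ⬝ᵥ P y`, leaving `M`, and
  -- half for `q ⬝ᵥ g`, leaving the constant. Stationarity makes the bound independent of `k`.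
  set M : Matrix (Fin n) (Fin n) ℝ := (-(2 / r)) • (Pᵀ * P) - P with hM
  refine ⟨∫ ω, quadForm M (Xs 0 ω - (xt + xs)) ∂μ - (2 * r)⁻¹ * sqNorm q, fun k X hX => ?_⟩
  rw [← hstat k, storage]
  have hyL : MemLp (fun ω => Xs k ω - (xt + xs)) 2 μ := (hXs k).sub (memLp_const _)
  have hi := hyL.integrable_quadForm M
  have hc : ∫ _ : Ω, (2 * r)⁻¹ * sqNorm q ∂μ = (2 * r)⁻¹ * sqNorm q := by simp
  rw [← hc, ← integral_sub hi (integrable_const _)]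
  refine integral_mono (hi.fun_sub (integrable_const _))
    (integrable_storage P S q xs xt hX (hXs k)) fun ω => ?_
  set g := X ω - (Xs k ω - xt) with hg
  set y := Xs k ω - (xt + xs) with hy
  have e1 : X ω - xs = g + y := by rw [hg, hy]; abel
  have h1 := two_mul_dotProduct_le (show (0 : ℝ) < r / 2 by positivity) g (P *ᵥ y)
  have h2 := two_mul_dotProduct_le hr g ((-1 : ℝ) • q)
  have h3 := hrS g
  have e2 : sqNorm ((-1 : ℝ) • q) = sqNorm q := by simp [sqNorm]
  simp only [hM, e1, quadForm_add_matrix, quadForm_sub_matrix, quadForm_smul_matrix,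
    quadForm_transpose_mul_self, quadForm_add hP.isSymm_real]
  rw [e2, dotProduct_smul, smul_eq_mul, dotProduct_comm g q] at h2
  have e3 : (r / 2)⁻¹ = 2 / r := by rw [inv_div]
  have e4 : (2 * r)⁻¹ * sqNorm q = r⁻¹ * sqNorm q / 2 := by field_simp
  rw [e3] at h1
  rw [e4]
  linarith

/-- The dissipation inequality in terms of a detectability storage matrix. -/
theorem le_integral_supply [IsProbabilityMeasure μ] (hQ₂ : D.Q₂.PosSemidef)
    (hR₂ : D.R₂.PosSemidef) {S : Matrix (Fin n) (Fin n) ℝ} {c : ℝ}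
    (hc : ∀ x u, c * sqNorm x + quadForm S (D.A *ᵥ x + D.B *ᵥ u)
        ≤ quadForm D.Q₁ x + quadForm D.R₁ u + quadForm S x)
    {X : Ω → Fin n → ℝ} {U : Ω → Fin l → ℝ} (hX : MemLp X 2 μ) (hU : MemLp U 2 μ) :
    c * ∫ ω, sqNorm (X ω) ∂μ ≤
      ∫ ω, (quadForm (D.Q₁ + D.Q₂) (X ω) + quadForm (D.R₁ + D.R₂) (U ω) + quadForm S (X ω)
        - quadForm S (D.A *ᵥ X ω + D.B *ᵥ U ω)) ∂μ
      - quadForm D.Q₂ (∫ ω, X ω ∂μ) - quadForm D.R₂ (∫ ω, U ω ∂μ) := by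
  have i1 := hX.integrable_quadForm D.Q₂
  have i2 := hU.integrable_quadForm D.R₂
  have i3 : Integrable (fun ω => c * sqNorm (X ω)) μ :=
    (hX.integrable_dotProduct hX).const_mul c
  have i4 : Integrable (fun ω => quadForm (D.Q₁ + D.Q₂) (X ω) + quadForm (D.R₁ + D.R₂) (U ω)
      + quadForm S (X ω) - quadForm S (D.A *ᵥ X ω + D.B *ᵥ U ω)) μ :=
    (((hX.integrable_quadForm _).add (hU.integrable_quadForm _)).add
      (hX.integrable_quadForm _)).sub
      (((hX.mulVec D.A).add (hU.mulVec D.B)).integrable_quadForm S)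
  have h1 := integral_mono ((i3.fun_add i1).fun_add i2) i4 fun ω => by
    have := hc (X ω) (U ω)
    simp only [quadForm_add_matrix]
    linarith
  rw [integral_add (i3.fun_add i1) i2, integral_add i3 i1, integral_const_mul] at h1
  linarith [quadForm_integral_le hQ₂ hX, quadForm_integral_le hR₂ hU]

section Stationary

theorem measurable_closedLoop_step {π : (Fin n → ℝ) → Fin l → ℝ} (hπ : Continuous π) :
    Measurable fun p : (Fin n → ℝ) × (Fin m → ℝ) => D.f p.1 (π p.1) p.2 := by
  refine Continuous.measurable ?_
  unfold f
  fun_prop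

/-- Independence makes the law of state and noise the product to which invariance of `ρ` applies. -/
theorem hasLaw_closedLoop [IsProbabilityMeasure μ] {W : ℕ → Ω → Fin m → ℝ}
    (hW_meas : ∀ k, Measurable (W k)) (hW_ident : ∀ k, IdentDistrib (W k) (W 0) μ μ)
    {π : (Fin n → ℝ) → Fin l → ℝ} (hπ : Continuous π) {ρ : Measure (Fin n → ℝ)}
    (hρ : D.IsInvariant π (μ.map (W 0)) ρ) {X₀ : Ω → Fin n → ℝ} (h₀ : HasLaw X₀ ρ μ)
    (hind : ∀ k, IndepFun (W k) (D.closedLoop W π X₀ k) μ) (k : ℕ) :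
    HasLaw (D.closedLoop W π X₀ k) ρ μ := by
  induction k with
  | zero => exact h₀
  | succ k ih =>
    have hWk : HasLaw (W k) (μ.map (W 0)) μ := ⟨(hW_meas k).aemeasurable, (hW_ident k).map_eq⟩
    have hpair := (hind k).symm.hasLaw_prod ih hWk
    have hF := D.measurable_closedLoop_step hπ
    rw [closedLoop_succ_eq_comp]
    refine ⟨hF.comp_aemeasurable hpair.aemeasurable, Eq.trans ?_ hρ⟩
    rw [← hpair.map_eq, AEMeasurable.map_map_of_aemeasurable hF.aemeasurable hpair.aemeasurable]

theorem memLp_of_hasLaw {X : Ω → Fin n → ℝ} {ρ : Measure (Fin n → ℝ)} (hρ : IsP2 ρ)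
    (hX : HasLaw X ρ μ) : MemLp X 2 μ := by
  rw [memLp_two_iff_integrable_sqNorm hX.aemeasurable.aestronglyMeasurable]
  have := hρ.2
  rw [← hX.map_eq] at this
  exact (integrable_map_measure continuous_sqNorm.aestronglyMeasurable hX.aemeasurable).1 this

theorem indepFun_closedLoop [IsProbabilityMeasure μ] {W : ℕ → Ω → Fin m → ℝ}
    (hW_meas : ∀ k, Measurable (W k)) (hW_indep : iIndepFun W μ)
    {π : (Fin n → ℝ) → Fin l → ℝ} (hπ : Continuous π) {X₀ : Ω → Fin n → ℝ}
    (hX₀ : AEMeasurable X₀ μ) (h₀ : IndepFun X₀ (fun ω k => W k ω) μ) (k : ℕ) :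
    IndepFun (W k) (D.closedLoop W π X₀ k) μ := by
  have hF := D.measurable_closedLoop_step hπ
  -- The induction needs independence from the whole present and future noise, not just from `W k`.
  have key : ∀ k, AEMeasurable (D.closedLoop W π X₀ k) μ ∧
      IndepFun (D.closedLoop W π X₀ k) (fun ω j => W (k + j) ω) μ := by
    intro k
    induction k with
    | zero => exact ⟨hX₀, by simp only [zero_add]; exact h₀⟩
    | succ k ih =>
      have htail : Measurable fun ω j => W (k + 1 + j) ω :=
        measurable_pi_lambda _ fun j => hW_meas _
      have h1 : IndepFun (D.closedLoop W π X₀ k) (fun ω => (W k ω, fun j => W (k + 1 + j) ω)) μ := by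
        have hψ : Measurable fun w : ℕ → Fin m → ℝ => (w 0, fun j => w (1 + j)) := by fun_prop
        have := ih.2.comp measurable_id hψ
        simpa only [Function.comp_def, id, add_zero, add_assoc] using this
      have h2 := h1.prodMk_left_of_prodMk_right ih.1 (hW_meas k).aemeasurable htail.aemeasurable
        (hW_indep.indepFun_tail hW_meas k)
      rw [closedLoop_succ_eq_comp]
      exact ⟨hF.comp_aemeasurable (ih.1.prodMk (hW_meas k).aemeasurable),
        h2.comp hF measurable_id⟩
  have := (key k).2.comp measurable_id (measurable_pi_apply 0)
  simpa only [Function.comp_def, id, add_zero] using this.symm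

end Stationary

theorem memLp_traj [IsProbabilityMeasure μ] {W : ℕ → Ω → Fin m → ℝ}
    (hW : ∀ k, MemLp (W k) 2 μ) {X₀ : Ω → Fin n → ℝ} (hX₀ : MemLp X₀ 2 μ)
    {U : ℕ → Ω → Fin l → ℝ} {N : ℕ} (hU : D.IsAdmissible μ W N X₀ U) :
    ∀ k ≤ N, MemLp (D.traj W X₀ U k) 2 μ := by
  intro k
  induction k with
  | zero => intro _; exact hX₀
  | succ k ih => intro hk; exact D.memLp_f (ih (by omega)) (hU k (by omega)).memLp (hW k)

/-- Strict dissipativity implies the turnpike property. -/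
theorem IsStrictlyDissipativeWith.hasMeanSquareTurnpike [IsProbabilityMeasure μ]
    {W : ℕ → Ω → Fin m → ℝ} (hW : ∀ k, MemLp (W k) 2 μ) {Xs : ℕ → Ω → Fin n → ℝ}
    {Us : ℕ → Ω → Fin l → ℝ} {lam : ℕ → (Ω → Fin n → ℝ) → ℝ} {α : ℝ → ℝ}
    (h : D.IsStrictlyDissipativeWith μ W Xs Us lam α) : D.HasMeanSquareTurnpike μ W Xs Us α := by
  intro X₀ hX₀
  obtain ⟨M, hM⟩ := h.bddBelow
  -- The telescoped storage contributes at most its initial value minus its lower bound, uniformly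
  -- in `N` and the control.
  refine ⟨lam 0 X₀ - M, fun N δ _ U hU hcost ε hε => ?_⟩
  have hmem := D.memLp_traj hW hX₀ hU
  set X := D.traj W X₀ U with hX
  have hα0 : ∀ r, 0 ≤ r → 0 ≤ α r := fun r hr => by
    rw [← h.kInfty.map_zero]
    exact h.kInfty.strictMonoOn.monotoneOn Set.self_mem_Ici hr hr
  have hαε : 0 < α ε := by
    rw [← h.kInfty.map_zero]
    exact h.kInfty.strictMonoOn Set.self_mem_Ici hε.le hε
  set dist : ℕ → ℝ := fun k => ∫ ω, sqNorm (X k ω - Xs k ω) ∂μ with hdist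
  have hdist0 : ∀ k, 0 ≤ dist k := fun k => integral_nonneg fun ω => sqNorm_nonneg _
  have hstep : ∀ k ∈ Finset.range N, α (dist k) ≤
      D.stageCost μ (X k) (U k) - D.stageCost μ (Xs k) (Us k)
        + (lam k (X k) - lam (k + 1) (X (k + 1))) := by
    intro k hk
    have hk' := Finset.mem_range.1 hk
    have hc := hU k hk'
    have := h.dissipation k (X k) (U k) (hmem k hk'.le) hc.memLp hc.indep_state hc.indep_control
    have e : X (k + 1) = fun ω => D.f (X k ω) (U k ω) (W k ω) := rfl
    rw [e]
    linarith
  have hsum := Finset.sum_le_sum hstep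
  rw [Finset.sum_add_distrib, Finset.sum_sub_distrib, Finset.sum_range_sub'] at hsum
  have hN := hM N (X N) (hmem N le_rfl)
  have hX0 : X 0 = X₀ := rfl
  rw [hX0] at hsum
  have hcost' : ∑ k ∈ Finset.range N, D.stageCost μ (X k) (U k) = D.cost μ W N X₀ U := rfl
  set bad := (Finset.range N).filter fun k => ¬ dist k ≤ ε with hbad
  have hcard : (((Finset.range N).filter fun k => dist k ≤ ε).card : ℝ) + bad.card = N := by
    have := Finset.card_filter_add_card_filter_not (s := Finset.range N) fun k => dist k ≤ ε
    rw [Finset.card_range] at this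
    exact_mod_cast this
  have hlow : bad.card * α ε ≤ ∑ k ∈ Finset.range N, α (dist k) := by
    calc (bad.card : ℝ) * α ε = ∑ k ∈ bad, α ε := by simp
      _ ≤ ∑ k ∈ bad, α (dist k) := by
        refine Finset.sum_le_sum fun k hk => ?_
        have hk2 := (Finset.mem_filter.1 hk).2
        push Not at hk2
        exact h.kInfty.strictMonoOn.monotoneOn hε.le (hdist0 k) hk2.le
      _ ≤ ∑ k ∈ Finset.range N, α (dist k) :=
        Finset.sum_le_sum_of_subset_of_nonneg (Finset.filter_subset _ _)
          fun k _ _ => hα0 _ (hdist0 k)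
  have hfin : (bad.card : ℝ) ≤ (δ + (lam 0 X₀ - M)) / α ε := by
    rw [le_div_iff₀ hαε]
    linarith
  linarith

end LQData

/-! ### The comparison function and the main theorem. -/

theorem isKInfty_const_mul {c : ℝ} (hc : 0 < c) : IsKInfty fun r => c * r where
  continuousOn := by fun_prop
  strictMonoOn := fun a _ b _ hab => mul_lt_mul_of_pos_left hab hc
  map_zero := mul_zero c
  tendsto_atTop := tendsto_id.const_mul_atTop hc

theorem mainTheorem2 {n l m : ℕ} (D : LQData n l m)
    {Ω : Type*} [MeasurableSpace Ω] (μ : Measure Ω) [IsProbabilityMeasure μ]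
    (W : ℕ → Ω → Fin m → ℝ)
    -- standing assumptions on the noise: i.i.d. and square integrable
    (hW_meas : ∀ k, Measurable (W k)) (hW_indep : iIndepFun W μ)
    (hW_ident : ∀ k, IdentDistrib (W k) (W 0) μ μ) (hW_L2 : MemLp (W 0) 2 μ)
    -- standing assumptions on the system and the cost
    (hAB : IsStabilizable D.A D.B)
    (hQ₁ : D.Q₁.PosSemidef) (hQ₂ : D.Q₂.PosSemidef)
    (hR₁ : D.R₁.PosDef) (hR₂ : D.R₂.PosSemidef)
    -- the mean dynamics have a steady state
    (xs : Fin n → ℝ) (us : Fin l → ℝ)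
    (hsteady : (1 - D.A) *ᵥ xs - D.B *ᵥ us = D.E *ᵥ (∫ ω, W 0 ω ∂μ) + D.z)
    (hdetect : IsDetectable D.A (CFC.sqrt D.Q₁)) :
    ∃ (P S : Matrix (Fin n) (Fin n) ℝ) (q xt : Fin n → ℝ) (ut : Fin l → ℝ)
      (ρ : Measure (Fin n → ℝ)) (α : ℝ → ℝ),
      P.PosSemidef ∧ D.IsRiccatiSolution P ∧ S.PosDef ∧
      (1 - D.A) *ᵥ xt - D.B *ᵥ ut = 0 ∧ IsKInfty α ∧
      IsP2 ρ ∧ D.IsInvariant (D.feedback P (xt + xs) (ut + us)) (μ.map (W 0)) ρ ∧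
      (CarriesInitialValues n μ W → ∃ Xs₀ : Ω → Fin n → ℝ, HasLaw Xs₀ ρ μ ∧
        ∀ k, IndepFun (W k) (D.closedLoop W (D.feedback P (xt + xs) (ut + us)) Xs₀ k) μ) ∧
      ∀ Xs₀ : Ω → Fin n → ℝ, HasLaw Xs₀ ρ μ →
        (∀ k, IndepFun (W k) (D.closedLoop W (D.feedback P (xt + xs) (ut + us)) Xs₀ k) μ) →
        ∀ (Xs : ℕ → Ω → Fin n → ℝ) (Us : ℕ → Ω → Fin l → ℝ),
          Xs = D.closedLoop W (D.feedback P (xt + xs) (ut + us)) Xs₀ →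
          Us = (fun k ω => D.feedback P (xt + xs) (ut + us) (Xs k ω)) →
          D.IsStationaryPair μ W Xs Us ∧
          D.IsStrictlyDissipativeWith μ W Xs Us (LQData.storage μ P S q xs xt Xs) α ∧
          D.HasMeanSquareTurnpike μ W Xs Us α := by
  have hQ : (D.Q₁ + D.Q₂).PosSemidef := hQ₁.add hQ₂
  have hR : (D.R₁ + D.R₂).PosDef := hR₁.add_posSemidef hR₂
  have hW : ∀ k, MemLp (W k) 2 μ := fun k => (hW_ident k).symm.memLp_snd hW_L2
  have hWmean : ∀ k, ∫ ω, W k ω ∂μ = ∫ ω, W 0 ω ∂μ := fun k => (hW_ident k).integral_eq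
  obtain ⟨P, hP, hPeq⟩ := hAB.exists_riccati hQ hR
  have hRic : D.IsRiccatiSolution P := hPeq
  obtain ⟨S, hS, c, hc, hSc⟩ := hdetect.exists_storage D.B hQ₁ hR₁
  -- the optimal steady state
  obtain ⟨xt, ut, p, hker, hoptt⟩ := exists_optimal_steadyState (A := D.A) (B := D.B) hQ₁ hR₁
    -- At a steady state the `S` terms of the detectability inequality cancel, so zero cost forces
    -- `x = 0`.
    (fun x u hx h0 => by
      have := hSc x u
      rw [← hx] at this
      have h1 := sqNorm_nonneg x
      exact sqNorm_eq_zero.1 (le_antisymm (by nlinarith) h1))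
    -- These are the gradients of the cost at `(xs, us)`: the optimization runs over the offset from
    -- that steady state.
    (D.s + (2 : ℝ) • (D.Q₁ *ᵥ xs)) (D.v + (2 : ℝ) • (D.R₁ *ᵥ us))
  obtain ⟨xe, hxe⟩ : ∃ xe, xe = xt + xs := ⟨_, rfl⟩
  obtain ⟨ue, hue⟩ : ∃ ue, ue = ut + us := ⟨_, rfl⟩
  have hopt : ∀ x u, 2 * (x ⬝ᵥ (D.Q₁ *ᵥ xe)) + 2 * (u ⬝ᵥ (D.R₁ *ᵥ ue)) + D.s ⬝ᵥ x + D.v ⬝ᵥ u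
      + p ⬝ᵥ (x - (D.A *ᵥ x + D.B *ᵥ u)) = 0 := by
    intro x u
    have h := hoptt x u
    rw [add_dotProduct, add_dotProduct, smul_dotProduct, smul_dotProduct,
      dotProduct_comm (D.Q₁ *ᵥ xs) x, dotProduct_comm (D.R₁ *ᵥ us) u] at h
    simp only [smul_eq_mul] at h
    rw [hxe, hue, Matrix.mulVec_add, Matrix.mulVec_add, dotProduct_add, dotProduct_add]
    linarith
  have hker' : (1 - D.A) *ᵥ xt - D.B *ᵥ ut = 0 := by
    rw [Matrix.sub_mulVec, Matrix.one_mulVec, sub_sub, ← hker, sub_self]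
  have hfix : D.f xe ue (∫ ω, W 0 ω ∂μ) = xe := by
    rw [Matrix.sub_mulVec, Matrix.one_mulVec] at hsteady hker'
    have h1 : D.f xe ue (∫ ω, W 0 ω ∂μ) - xe
        = D.E *ᵥ (∫ ω, W 0 ω ∂μ) + D.z - (xs - D.A *ᵥ xs - D.B *ᵥ us)
          - (xt - D.A *ᵥ xt - D.B *ᵥ ut) := by
      simp only [LQData.f, hxe, hue, Matrix.mulVec_add]; abel
    rw [hsteady, hker', sub_self, sub_zero] at h1
    exact sub_eq_zero.1 h1
  -- the closed loop is contracting
  set Acl := D.A + D.B * D.gain P with hAcl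
  have hAclx : ∀ x, Acl *ᵥ x = D.A *ᵥ x + D.B *ᵥ (D.gain P *ᵥ x) := fun x => by
    rw [hAcl, Matrix.add_mulVec, Matrix.mulVec_mulVec]
  have hT : (P + S).PosDef := Matrix.PosDef.posSemidef_add hP hS
  -- Under the optimal feedback the `P`-form decreases by the full running cost, which covers the
  -- possible growth of the `S`-form and still leaves `c‖x‖²`.
  have hcontr : ∀ x, quadForm (P + S) (Acl *ᵥ x) + c * sqNorm x ≤ quadForm (P + S) x := by
    intro x
    have h1 := bellman_eq (A := D.A) (B := D.B) (Q := D.Q₁ + D.Q₂) hP hR x (D.gain P *ᵥ x)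
    have hK : riccatiGain D.A D.B (D.R₁ + D.R₂) P = D.gain P := rfl
    rw [← hPeq, hK, sub_self, quadForm_zero, add_zero, ← hAclx] at h1
    have h2 := hSc x (D.gain P *ᵥ x)
    rw [← hAclx] at h2
    simp only [quadForm_add_matrix] at h1 ⊢
    linarith [hQ₂.quadForm_nonneg x, hR₂.quadForm_nonneg (D.gain P *ᵥ x)]
  have hπ := D.continuous_feedback P xe ue
  have hprob : IsProbabilityMeasure (μ.map (W 0)) :=
    Measure.isProbabilityMeasure_map (hW_meas 0).aemeasurable
  obtain ⟨ρ, hρ, hinv⟩ : ∃ ρ : Measure (Fin n → ℝ), IsP2 ρ ∧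
      D.IsInvariant (D.feedback P xe ue) (μ.map (W 0)) ρ := by
    obtain ⟨κ, γ, hγ, hγ1, hpow⟩ := exists_geometric_bound hT hc hcontr
    have hLp : MemLp (fun w : Fin m → ℝ => w) 2 (μ.map (W 0)) :=
      (memLp_map_measure_iff aestronglyMeasurable_id (hW_meas 0).aemeasurable).2 hW_L2
    have hh : MemLp (fun w => D.f 0 (D.feedback P xe ue 0) w) 2 (μ.map (W 0)) :=
      D.memLp_f (memLp_const _) (memLp_const _) hLp
    have hm : Measurable fun w => D.f 0 (D.feedback P xe ue 0) w :=
      Continuous.measurable (by unfold LQData.f; fun_prop)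
    -- The affine offset of the closed loop is put into the driving term, whose mean need not
    -- vanish.
    obtain ⟨ρ, hρ, h⟩ := exists_invariant_law hγ hγ1 hpow (μ.map (W 0)) hm hh
    refine ⟨ρ, hρ, Eq.trans ?_ h⟩
    congr 1
    funext x
    rw [hAclx]
    simp only [LQData.f, LQData.feedback, Matrix.mulVec_add, Matrix.mulVec_sub, Matrix.mulVec_zero]
    abel
  rw [hxe] at hinv
  rw [hue] at hinv
  refine ⟨P, S, p - (2 : ℝ) • (S *ᵥ xt), xt, ut, ρ, fun r => c * r, hP, hRic, hS, hker',
    isKInfty_const_mul hc, hρ, hinv, fun hcarry => ?_, ?_⟩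
  · rw [← hxe, ← hue]
    obtain ⟨X₀, hX₀, hind⟩ := hcarry ρ hρ
    exact ⟨X₀, hX₀, fun k => D.indepFun_closedLoop hW_meas hW_indep hπ hX₀.aemeasurable hind k⟩
  rw [← hxe, ← hue] at hinv ⊢
  intro Xs₀ hXs₀ hind Xs Us hXs hUs
  have hlaw : ∀ k, HasLaw (Xs k) ρ μ := fun k => by
    rw [hXs]; exact D.hasLaw_closedLoop hW_meas hW_ident hπ hinv hXs₀ hind k
  rw [← hXs] at hind
  have hdyn : ∀ k ω, Xs (k + 1) ω = D.f (Xs k ω) (D.feedback P xe ue (Xs k ω)) (W k ω) :=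
    fun k ω => by rw [hXs]; rfl
  have hXsL : ∀ k, MemLp (Xs k) 2 μ := fun k => LQData.memLp_of_hasLaw hρ (hlaw k)
  have hUsL : ∀ k, MemLp (Us k) 2 μ := fun k => by
    rw [hUs]; exact D.memLp_feedback P xe ue (hXsL k)
  have hexp : ∀ k (F : (Fin n → ℝ) → ℝ), Continuous F → ∫ ω, F (Xs k ω) ∂μ = ∫ x, F x ∂ρ := by
    intro k F hF
    rw [← (hlaw k).map_eq, integral_map (hlaw k).aemeasurable hF.aestronglyMeasurable]
  have hquad : ∀ k (M : Matrix (Fin n) (Fin n) ℝ),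
      ∫ ω, quadForm M (Xs k ω - xe) ∂μ = ∫ x, quadForm M (x - xe) ∂ρ := fun k M =>
    hexp k (fun x => quadForm M (x - xe)) (by unfold quadForm; fun_prop)
  have hmeanρ : ∀ k, ∫ ω, Xs k ω ∂μ = ∫ x, x ∂ρ := by
    intro k
    rw [← (hlaw k).map_eq,
      integral_map (hlaw k).aemeasurable (f := fun x => x) aestronglyMeasurable_id]
  have hmean : ∀ k, ∫ ω, Xs k ω ∂μ = xe := by
    intro k
    have hyI : Integrable (fun ω => Xs k ω - xe) μ :=
      ((hXsL k).sub (memLp_const _)).integrable (by norm_num)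
    have hVI : Integrable (fun ω => W k ω - ∫ ω, W 0 ω ∂μ) μ :=
      ((hW k).sub (memLp_const _)).integrable (by norm_num)
    have hpt : ∀ ω, Xs (k + 1) ω
        = Acl *ᵥ (Xs k ω - xe) + D.E *ᵥ (W k ω - ∫ ω, W 0 ω ∂μ) + xe := by
      intro ω
      have h1 := D.f_add hfix (Xs k ω - xe) (D.gain P *ᵥ (Xs k ω - xe)) (W k ω)
      rw [sub_add_cancel, ← hAclx] at h1
      rw [hdyn, ← h1]; rfl
    have hAI : Integrable (fun ω => Acl *ᵥ (Xs k ω - xe)) μ :=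
      (((hXsL k).sub (memLp_const _)).mulVec Acl).integrable (by norm_num)
    have hEI : Integrable (fun ω => D.E *ᵥ (W k ω - ∫ ω, W 0 ω ∂μ)) μ :=
      (((hW k).sub (memLp_const _)).mulVec D.E).integrable (by norm_num)
    have hstep : ∫ ω, Xs (k + 1) ω ∂μ = Acl *ᵥ (∫ ω, Xs k ω ∂μ - xe) + xe := by
      simp only [hpt]
      rw [integral_add (hAI.fun_add hEI) (integrable_const _), integral_add hAI hEI,
        integral_mulVec _ hyI, integral_mulVec _ hVI,
        integral_sub ((hXsL k).integrable (by norm_num)) (integrable_const _),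
        integral_sub ((hW k).integrable (by norm_num)) (integrable_const _), hWmean]
      simp
    -- By stationarity the centred mean is a fixed point of `Acl`, and the strict decrease of `P +
    -- S` leaves only zero.
    rw [hmeanρ (k + 1), ← hmeanρ k] at hstep
    set a := ∫ ω, Xs k ω ∂μ with ha
    have h2 : Acl *ᵥ (a - xe) = a - xe := by
      rw [eq_sub_iff_add_eq]; exact hstep.symm
    have h3 := hcontr (a - xe)
    rw [h2] at h3
    have h4 := sqNorm_nonneg (a - xe)
    exact sub_eq_zero.1 (sqNorm_eq_zero.1 (le_antisymm (by nlinarith) h4))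
  have hdiss : D.IsStrictlyDissipativeWith μ W Xs Us
      (LQData.storage μ P S (p - (2 : ℝ) • (S *ᵥ xt)) xs xt Xs) (fun r => c * r) := by
    refine ⟨isKInfty_const_mul hc, ?_, fun k X U hX hU hXW hUW => ?_⟩
    · refine LQData.storage_bddBelow hP hS _ xs xt hXsL fun k M => ?_
      rw [← hxe, hquad, hquad]
    · have hfixk : D.f xe ue (∫ ω, W k ω ∂μ) = xe := by rw [hWmean]; exact hfix
      have h := D.dissipation_eq hQ₁ hR₁ hR₂ hP hRic hS hxe rfl hopt (hW k) hfixk (hXsL k)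
        (hmean k) (hind k) (hdyn k) (by rw [hquad, hquad]) hX hU hXW hUW
      have hUk : Us k = fun ω => D.feedback P xe ue (Xs k ω) := by rw [hUs]
      rw [hUk, h]
      exact D.le_integral_supply hQ₂ hR₂ hSc (hX.sub (hXsL k))
        (hU.sub (D.memLp_feedback P xe ue (hXsL k)))
  refine ⟨⟨fun k => ⟨hUsL k, ?_, hind k, ?_⟩, ⟨ρ, hρ, hlaw⟩, ?_, ?_⟩, hdiss,
    hdiss.hasMeanSquareTurnpike D hW⟩
  · rw [hUs]
    refine AEStronglyMeasurable.mono (m := MeasurableSpace.comap (Xs k) inferInstance) ?_ ?_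
    · exact le_iSup₂ (f := fun j (_ : j ∈ Finset.range (k + 1)) =>
        MeasurableSpace.comap (Xs j) inferInstance) k (Finset.self_mem_range_succ k)
    · exact (hπ.measurable.comp (comap_measurable (Xs k))).stronglyMeasurable.aestronglyMeasurable
  · rw [hUs]
    exact (hind k).comp measurable_id hπ.measurable
  · have hl : ∀ k, HasLaw (Us k) (ρ.map (D.feedback P xe ue)) μ := fun k => by
      refine ⟨(hUsL k).aestronglyMeasurable.aemeasurable, ?_⟩
      rw [← (hlaw k).map_eq, AEMeasurable.map_map_of_aemeasurable hπ.measurable.aemeasurable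
        (hlaw k).aemeasurable, hUs]
      rfl
    refine ⟨_, ⟨?_, ?_⟩, hl⟩
    · have := hρ.1
      exact Measure.isProbabilityMeasure_map hπ.measurable.aemeasurable
    · rw [← (hl 0).map_eq, integrable_map_measure continuous_sqNorm.aestronglyMeasurable
        (hl 0).aemeasurable]
      exact (memLp_two_iff_integrable_sqNorm (hUsL 0).aestronglyMeasurable).1 (hUsL 0)
  · intro k ω
    rw [hdyn, hUs]
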